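/- \textbf{Model.} Fix a battery capacity $B\ge 1$, an age bound $\Delta^{\max}\ge 1$, an energy rate $\lambda\in[0,1]$ and a request probability $p\in[0,1]$. At slot $t$ the state is $(b(t),r(t),\Delta(t),\tilde b(t))$ with battery level $b\in\{0,\dots,B\}$ (hidden), request indicator $r\in\{0,1\}$, age $\Delta\in\{1,\dots,\Delta^{\max}\}$ and partial battery knowledge $\tilde b\in\{1,\dots,B\}$ (the last three are observed). Given the action $a(t)\in\{0,1\}$, let $d(t)=a(t)\mathbf 1_{\{b(t)\ge 1\}}$. Then $b(t+1)=\min\{b(t)+e(t)-d(t),B\}$, $\Delta(t+1)=\min\{(1-d(t))\Delta(t)+1,\Delta^{\max}\}$, $\tilde b(t+1)=b(t)$ if $d(t)=1$ and $\tilde b(t+1)=\tilde b(t)$ otherwise, where $e(t)\sim\mathrm{Bernoulli}(\lambda)$ and $r(t+1)\sim\mathrm{Bernoulli}(p)$ are independent of each other and of the past. The cost at slot $t$ is the on-demand age of information $\Delta^{\mathrm{OD}}(t)=r(t)\Delta(t+1)$. The belief $\beta_j(t)$ is the conditional probability of $b(t)=j$ given the complete information state (initial belief-state, and all observations and actions so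 far); the belief-state is $z(t)=(\beta(t),r(t),\Delta(t),\tilde b(t))\in\mathcal Z$, where $\mathcal Z$ consists of all $(\beta,r,\Delta,\tilde b)$ with $\beta$ a probability vector on $\{0,\dots,B\}$. A policy is a (possibly randomized) rule $\pi(a\mid z)$, and its average cost from $z(0)$ is $$\bar C_\pi(z(0))=\limsup_{T\to\infty}\frac1T\sum_{t=1}^T\mathbb E_\pi[\Delta^{\mathrm{OD}}(t)\mid z(0)].$$ Let $\boldsymbol\Lambda$ be the $(B+1)\times(B+1)$ matrix, with rows and columns indexed by $0,\dots,B$, with $\Lambda_{jj}=1-\lambda$ and $\Lambda_{j+1,j}=\lambda$ for $j<B$, $\Lambda_{BB}=1$, and all other entries $0$. Let $\rho^j$, $1\le j\le B$, be the vector with entries $1-\lambda$ at index $j-1$ and $\lambda$ at index $j$ and zeros elsewhere, and $\rho^0=\rho^1$. For $h:\mathcal Z\to\mathbb R$ and $z=(\beta,r,\Delta,\tilde b)$, with $\Delta^+=\min\{\Delta+1,\Delta^{\max}\}$ and $q(r')=r'p+(1-r')(1-p)$, put $$Q(z,0)=r\Delta^+ +\sum_{r'=0}^1 q(r')\,h(\boldsymbol\Lambda\beta,r',\Delta^+,\tilde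 b),$$ $$Q(z,1)=r[\beta_0\Delta^+ +(1-\beta_0)]+\beta_0\sum_{r'=0}^1 q(r')\,h(\rho^0,r',\Delta^+,\tilde b)+\sum_{j=1}^B\beta_j\big[p\,h(\rho^j,1,1,j)+(1-p)\,h(\rho^j,0,1,j)\big].$$ \textbf{Theorem.} The Bellman equation $$\bar C^*+h(z)=\min_{a\in\{0,1\}}Q(z,a),\qquad z\in\mathcal Z,$$ has a solution $(\bar C^*,h)$ with $\bar C^*\in\mathbb R$ and $h$ bounded. For every such solution with $h$ bounded: (i) $\bar C^*=\min_\pi\bar C_\pi(z(0))$ for every initial belief-state $z(0)\in\mathcal Z$, so the optimal average cost does not depend on $z(0)$; moreover, even for policies that use the whole complete information state, the lower limit of the running average cost is at least $\bar C^*$; (ii) every deterministic policy $\pi^*$ with $\pi^*(z)\in\operatorname{argmin}_{a}Q(z,a)$ for all $z\in\mathcal Z$ is optimal: from every $z(0)\in\mathcal Z$ its running average cost converges to $\bar C^*$. -/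

import Mathlib

open Filter Topology

noncomputable section

/-- A Bernoulli random variable which is `true` with probability `q`. -/
def coin (q : ℝ) (h0 : 0 ≤ q) (h1 : q ≤ 1) : PMF Bool :=
  PMF.ofFintype (fun b => ENNReal.ofReal (if b then q else 1 - q)) (by
    simp only [Fintype.sum_bool, if_true, Bool.false_eq_true, if_false]
    rw [← ENNReal.ofReal_add h0 (by linarith)]
    simp)

/-- The expected value of a real function under a discrete law. -/
def PMF.expVal {α : Type*} (μ : PMF α) (f : α → ℝ) : ℝ := ∑' x, (μ x).toReal * f x

/-- The parameters of the single-sensor system: battery capacity `B`, upper bound `Δmax` on the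
age of information, energy harvesting rate `lam`, request probability `p`. -/
structure SensorModel where
  B : ℕ
  Δmax : ℕ
  lam : ℝ
  p : ℝ
  one_le_B : 1 ≤ B
  one_le_Δmax : 1 ≤ Δmax
  lam_nonneg : 0 ≤ lam
  lam_le_one : lam ≤ 1
  p_nonneg : 0 ≤ p
  p_le_one : p ≤ 1

/-- The observable part of the system state: request indicator `r`, age of information `Δ`,
partial battery knowledge `b̃`. The admissible values are those in `Obs.Valid`. -/
@[ext] structure Obs where
  r : Bool
  Δ : ℕ
  bt : ℕ

/-- The system state: the hidden battery level `b` and the observable part `o`. -/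
@[ext] structure SysState (M : SensorModel) where
  b : Fin (M.B + 1)
  o : Obs

/-- A belief-state `z = (β, r, Δ, b̃)`; the belief-state space is `SensorModel.Z`. -/
@[ext] structure BeliefState (M : SensorModel) where
  β : Fin (M.B + 1) → ℝ
  o : Obs

/-- The complete information state of the edge node: the initial belief-state, followed by the
sequence of the actions taken and of the observations received after them. -/
inductive Info (M : SensorModel)
  | start (z₀ : BeliefState M)
  | extend (φ : Info M) (a : Bool) (o : Obs)

namespace SensorModel

variable (M : SensorModel)

/-! ### System dynamics. Actions are Booleans: `true` is the command action `a = 1`. -/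

/-- Whether an update is sent: `d = a 𝟙{b ≥ 1}`. -/
def sends (b : Fin (M.B + 1)) (a : Bool) : Bool := a && decide (1 ≤ (b : ℕ))

/-- The age of information at the next slot. -/
def nextAge (s : SysState M) (a : Bool) : ℕ :=
  min ((1 - (M.sends s.b a).toNat) * s.o.Δ + 1) M.Δmax

/-- The next state when the energy arrival is `e` and the next request indicator is `r'`:
`b' = min (b + e - d) B`, and the partial battery knowledge becomes `b` if an update is sent. -/
def nextState (s : SysState M) (a e r' : Bool) : SysState M where
  b := ⟨min ((s.b : ℕ) + e.toNat - (M.sends s.b a).toNat) M.B, by omega⟩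
  o := { r := r'
         Δ := M.nextAge s a
         bt := if M.sends s.b a then (s.b : ℕ) else s.o.bt }

/-- The state transition law `Pr(s' | s, a)`: the energy arrival and the next request indicator
are independent Bernoulli variables with means `lam` and `p`. -/
def step (s : SysState M) (a : Bool) : PMF (SysState M) :=
  (coin M.lam M.lam_nonneg M.lam_le_one).bind fun e =>
    (coin M.p M.p_nonneg M.p_le_one).map fun r' => M.nextState s a e r'

/-- The immediate cost, i.e. the on-demand age of information `r(t) Δ(t+1)`. -/
def cost (s : SysState M) (a : Bool) : ℝ := (s.o.r.toNat : ℝ) * (M.nextAge s a : ℝ)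

/-! ### Beliefs -/

/-- Admissible observations: `Δ ∈ {1, …, Δmax}` and `b̃ ∈ {1, …, B}`. -/
def ValidObs (o : Obs) : Prop := (1 ≤ o.Δ ∧ o.Δ ≤ M.Δmax) ∧ (1 ≤ o.bt ∧ o.bt ≤ M.B)

/-- The belief-state space `𝒵`. -/
def Z : Set (BeliefState M) :=
  {z | ((∀ j, 0 ≤ z.β j) ∧ ∑ j, z.β j = 1) ∧ M.ValidObs z.o}

variable {M} in
/-- The most recent observation. -/
def _root_.Info.obs : Info M → Obs
  | .start z₀ => z₀.o
  | .extend _ _ o => o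

variable {M} in
/-- The joint probability that the observations recorded in `φ` occur and that the current battery
level is `j`, when the initial battery level has law `z₀.β` and the recorded actions are taken. -/
def _root_.Info.jointProb : Info M → Fin (M.B + 1) → ℝ
  | .start z₀, j => z₀.β j
  | .extend φ a o', j =>
      ∑ i, φ.jointProb i * (M.step ⟨i, φ.obs⟩ a ⟨j, o'⟩).toReal

variable {M} in
/-- The belief: the conditional probability that the current battery level is `j`, given the
complete information state `φ`. -/
def _root_.Info.belief (φ : Info M) (j : Fin (M.B + 1)) : ℝ :=
  φ.jointProb j / ∑ i, φ.jointProb i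

variable {M} in
/-- The belief-state reached at the complete information state `φ`. -/
def _root_.Info.beliefState (φ : Info M) : BeliefState M := ⟨φ.belief, φ.obs⟩

/-! ### Policies and average cost -/

/-- General randomized policies of the edge node: the law of the action may depend on the whole
complete information state. -/
abbrev InfoPolicy := Info M → PMF Bool

/-- Randomized policies `π(a | z)` on belief-states. -/
abbrev Policy := BeliefState M → PMF Bool

variable {M} in
/-- A belief-state policy takes the action prescribed at the current belief-state. -/
def Policy.toInfo (π : M.Policy) : M.InfoPolicy := fun φ => π φ.beliefState

/-- A deterministic policy `π : 𝒵 → {0, 1}` as a randomized one. -/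
def detPolicy (π : BeliefState M → Bool) : M.Policy := fun z => PMF.pure (π z)

/-- The law of the battery level and the complete information state at time `t`, started from
battery level `b₀` and information state `start z₀`, under the policy `σ`. -/
def law (σ : M.InfoPolicy) (z₀ : BeliefState M) (b₀ : Fin (M.B + 1)) :
    ℕ → PMF (Fin (M.B + 1) × Info M)
  | 0 => PMF.pure (b₀, .start z₀)
  | t + 1 => (law σ z₀ b₀ t).bind fun x =>
      (σ x.2).bind fun a =>
        (M.step ⟨x.1, x.2.obs⟩ a).map fun s' => (s'.b, x.2.extend a s'.o)

/-- `E_σ[Δ^OD(t) | z(0) = z₀]`: the initial battery level has law `z₀.β`, the current action is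
drawn from `σ`. -/
def expAoI (σ : M.InfoPolicy) (z₀ : BeliefState M) (t : ℕ) : ℝ :=
  ∑ b₀, z₀.β b₀ *
    ((M.law σ z₀ b₀ t).bind fun x => (σ x.2).map fun a => (x, a)).expVal
      (fun y => M.cost ⟨y.1.1, y.1.2.obs⟩ y.2)

/-- The average on-demand age of information over the slots `1, …, T`. -/
def runningAvg (σ : M.InfoPolicy) (z₀ : BeliefState M) (T : ℕ) : ℝ :=
  (1 / (T : ℝ)) * ∑ t ∈ Finset.Icc 1 T, M.expAoI σ z₀ t

/-- The average cost of a policy; the upper limit is used because the limit may fail to exist. -/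
def avgCost (σ : M.InfoPolicy) (z₀ : BeliefState M) : ℝ :=
  limsup (fun T => M.runningAvg σ z₀ T) atTop

/-! ### The Bellman equation -/

/-- The banded left stochastic matrix `Λ`. -/
def Λmat : Matrix (Fin (M.B + 1)) (Fin (M.B + 1)) ℝ := fun i j =>
  if (i : ℕ) = j then (if (j : ℕ) = M.B then 1 else 1 - M.lam)
  else if (i : ℕ) = j + 1 then M.lam else 0

/-- The vectors `ρ^0 = ρ^1 = (1-λ, λ, 0, …)` and, for `j ≥ 1`, `ρ^j` with entries `1-λ` and `λ` at
positions `j-1` and `j`. -/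
def ρ (j : ℕ) : Fin (M.B + 1) → ℝ := fun i =>
  if (i : ℕ) = max j 1 - 1 then 1 - M.lam
  else if (i : ℕ) = max j 1 then M.lam else 0

/-- `Pr(r') = r' p + (1 - r')(1 - p)`. -/
def reqProb (r' : Bool) : ℝ := (r'.toNat : ℝ) * M.p + (1 - (r'.toNat : ℝ)) * (1 - M.p)

/-- The action-value `Q(z, 0)` associated with `h`. -/
def Q0 (h : BeliefState M → ℝ) (z : BeliefState M) : ℝ :=
  (z.o.r.toNat : ℝ) * (min (z.o.Δ + 1) M.Δmax : ℕ) +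
    ∑ r' : Bool, M.reqProb r' *
      h ⟨M.Λmat.mulVec z.β, ⟨r', min (z.o.Δ + 1) M.Δmax, z.o.bt⟩⟩

/-- The action-value `Q(z, 1)` associated with `h`. -/
def Q1 (h : BeliefState M → ℝ) (z : BeliefState M) : ℝ :=
  (z.o.r.toNat : ℝ) * (z.β 0 * (min (z.o.Δ + 1) M.Δmax : ℕ) + (1 - z.β 0)) +
    z.β 0 * ∑ r' : Bool, M.reqProb r' *
      h ⟨M.ρ 0, ⟨r', min (z.o.Δ + 1) M.Δmax, z.o.bt⟩⟩ +
    ∑ j ∈ Finset.univ.erase (0 : Fin (M.B + 1)), z.β j *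
      (M.p * h ⟨M.ρ j, ⟨true, 1, j⟩⟩ + (1 - M.p) * h ⟨M.ρ j, ⟨false, 1, j⟩⟩)

/-- The action-value function `Q(z, a)` associated with `h`. -/
def Q (h : BeliefState M → ℝ) (z : BeliefState M) (a : Bool) : ℝ :=
  if a then M.Q1 h z else M.Q0 h z

/-- `(C, h)` solves the average-cost Bellman equation on `𝒵`, with a relative value function `h`
that is bounded on `𝒵`. -/
def SolvesBellman (C : ℝ) (h : BeliefState M → ℝ) : Prop :=
  (∃ K : ℝ, ∀ z ∈ M.Z, |h z| ≤ K) ∧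
    ∀ z ∈ M.Z, C + h z = min (M.Q h z false) (M.Q h z true)

/-- `π(z) ∈ argmin_a Q(z, a)` for every `z ∈ 𝒵`. -/
def IsGreedy (h : BeliefState M → ℝ) (π : BeliefState M → Bool) : Prop :=
  ∀ z ∈ M.Z, ∀ a : Bool, M.Q h z (π z) ≤ M.Q h z a

end SensorModel

end

/-! ### Expectations under discrete laws. -/

noncomputable section

namespace PMF

variable {α β : Type*}

/-! There are two halves: any bounded solution of the Bellman equation is verified by telescoping,
and a bounded solution is constructed by vanishing discount.

Verification. Instead of conditional laws, which are ill-behaved on null histories, one carries the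
unnormalized law `Info.jointProb` and the homogeneous extension `weighted` of `h`. Filtering is then
linear in the joint law, and `sum_cost_add_obsSum` shows that the current cost plus `h` at the next
belief-state is the mass of the history times `Q`. Averaged over histories, the Bellman equation
gives `C + H t ≤ cost + H (t + 1)` for every history-dependent policy, with equality for a greedy
one. Since `H` is bounded by `K`, the running averages are within `2K/T` of `C` on the relevant
side. This requires `2 ≤ Δmax`. If `Δmax = 1`, a failed command may produce the same observation as
a successful one, so `Q1` no longer describes the filter. The cost is then just `r(t)`, and
boundedness of `h` forces `C = p` (`eq_p_of_Δmax_eq_one`).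

Existence. Value iteration from zero increases to a discounted value `V`, monotone in age and in the
stochastic order of the battery. The point is an oscillation bound uniform in the discount factor
(`exists_uniform_bound`). If `lam > 0`, compare with `fullValue`, the value just after a success
from a full battery. This is nearly the best value, by monotonicity and a drift inequality. It is
also nearly the worst: idling `B` slots and then sending reaches it with probability at least `lam ^
B`. If `lam = 0`, compare with the cost of never sending; the finite energy supply changes it only
by a bounded amount. Centred values then converge pointwise along an ultrafilter, and so do the
discounted equations. -/

theorem summable_toReal (μ : PMF α) : Summable fun x => (μ x).toReal :=
  ENNReal.summable_toReal μ.tsum_coe_ne_top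

theorem tsum_toReal (μ : PMF α) : ∑' x, (μ x).toReal = 1 := by
  rw [← ENNReal.tsum_toReal_eq (fun x => μ.apply_ne_top x), μ.tsum_coe, ENNReal.toReal_one]

theorem summable_toReal_mul (μ : PMF α) {f : α → ℝ} {K : ℝ} (hf : ∀ x, |f x| ≤ K) :
    Summable fun x => (μ x).toReal * f x := by
  refine Summable.of_norm_bounded (μ.summable_toReal.mul_right K) fun x => ?_
  rw [norm_mul, Real.norm_of_nonneg ENNReal.toReal_nonneg]
  exact mul_le_mul_of_nonneg_left (hf x) ENNReal.toReal_nonneg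

theorem expVal_const (μ : PMF α) (c : ℝ) : μ.expVal (fun _ => c) = c := by
  simp only [expVal]
  rw [tsum_mul_right, tsum_toReal, one_mul]

theorem abs_expVal_le (μ : PMF α) {f : α → ℝ} {K : ℝ} (hf : ∀ x, |f x| ≤ K) :
    |μ.expVal f| ≤ K := by
  have hs := (μ.summable_toReal_mul hf).abs
  calc |μ.expVal f| ≤ ∑' x, |(μ x).toReal * f x| := by
        simpa [expVal] using norm_tsum_le_tsum_norm (f := fun x => (μ x).toReal * f x)
          (by simpa using hs)
    _ ≤ ∑' x, (μ x).toReal * K := by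
        refine hs.tsum_le_tsum (fun x => ?_) (μ.summable_toReal.mul_right K)
        rw [abs_mul, abs_of_nonneg ENNReal.toReal_nonneg]
        exact mul_le_mul_of_nonneg_left (hf x) ENNReal.toReal_nonneg
    _ = K := by rw [tsum_mul_right, tsum_toReal, one_mul]

theorem expVal_pure (a : α) (f : α → ℝ) : (PMF.pure a).expVal f = f a := by
  classical
  rw [expVal, tsum_eq_single a]
  · simp
  · intro b hb
    simp [hb]

theorem expVal_fintype [Fintype α] (μ : PMF α) (f : α → ℝ) :
    μ.expVal f = ∑ x, (μ x).toReal * f x := tsum_fintype _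

/-- Fubini for the double series; the bound on `f` supplies absolute summability. -/
theorem expVal_bind (μ : PMF α) (ν : α → PMF β) {f : β → ℝ} {K : ℝ} (hf : ∀ x, |f x| ≤ K) :
    (μ.bind ν).expVal f = μ.expVal fun x => (ν x).expVal f := by
  have hb : ∀ y, ((μ.bind ν) y).toReal = ∑' x, (μ x).toReal * (ν x y).toReal := by
    intro y
    have hn : ∀ x, μ x * ν x y ≠ ⊤ :=
      fun x => ENNReal.mul_ne_top (μ.apply_ne_top x) ((ν x).apply_ne_top y)
    rw [PMF.bind_apply, ENNReal.tsum_toReal_eq hn]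
    simp only [ENNReal.toReal_mul]
  have hK : Summable fun q : α × β => (μ q.1).toReal * ((ν q.1 q.2).toReal * K) := by
    have h1 : Summable fun q : α × β => (μ q.1).toReal * (ν q.1 q.2).toReal := by
      have h0 : (0 : α × β → ℝ) ≤ fun q => (μ q.1).toReal * (ν q.1 q.2).toReal := by
        intro q
        exact mul_nonneg (ENNReal.toReal_nonneg (a := μ q.1))
          (ENNReal.toReal_nonneg (a := ν q.1 q.2))
      have h2 : ∀ x, Summable fun y => (μ x).toReal * (ν x y).toReal := by
        intro x
        exact Summable.mul_left (μ x).toReal (ν x).summable_toReal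
      have h3 : Summable fun x => ∑' y, (μ x).toReal * (ν x y).toReal := by
        simp only [tsum_mul_left, tsum_toReal, mul_one]
        exact μ.summable_toReal
      exact (summable_prod_of_nonneg h0).2 ⟨h2, h3⟩
    simpa only [mul_assoc] using h1.mul_right K
  have hs : Summable fun q : α × β => (μ q.1).toReal * ((ν q.1 q.2).toReal * f q.2) := by
    refine Summable.of_norm_bounded hK fun q => ?_
    rw [norm_mul, norm_mul, Real.norm_of_nonneg ENNReal.toReal_nonneg,
      Real.norm_of_nonneg ENNReal.toReal_nonneg]
    exact mul_le_mul_of_nonneg_left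
      (mul_le_mul_of_nonneg_left (hf _) ENNReal.toReal_nonneg) ENNReal.toReal_nonneg
  have hc : ∑' y, ∑' x, (μ x).toReal * ((ν x y).toReal * f y) =
      ∑' x, ∑' y, (μ x).toReal * ((ν x y).toReal * f y) :=
    Summable.tsum_comm (f := fun x y => (μ x).toReal * ((ν x y).toReal * f y)) hs
  simp only [expVal]
  calc ∑' y, ((μ.bind ν) y).toReal * f y
      = ∑' y, ∑' x, (μ x).toReal * ((ν x y).toReal * f y) := by
        refine tsum_congr fun y => ?_
        rw [hb, ← tsum_mul_right]
        simp only [mul_assoc]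
    _ = ∑' x, ∑' y, (μ x).toReal * ((ν x y).toReal * f y) := hc
    _ = _ := by simp only [tsum_mul_left]

theorem expVal_map (μ : PMF α) (g : α → β) {f : β → ℝ} {K : ℝ} (hf : ∀ x, |f x| ≤ K) :
    (μ.map g).expVal f = μ.expVal (f ∘ g) := by
  rw [PMF.map, expVal_bind _ _ hf]
  simp only [Function.comp, Function.comp_def, expVal_pure]

theorem apply_toReal_eq_expVal [DecidableEq α] (μ : PMF α) (a : α) :
    (μ a).toReal = μ.expVal (fun x => if x = a then 1 else 0) := by
  rw [expVal, tsum_eq_single a]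
  · simp
  · intro b hb
    simp [hb]

end PMF

/-! ### The transition law of the system. -/

theorem coin_toReal (q : ℝ) (h0 : 0 ≤ q) (h1 : q ≤ 1) (b : Bool) :
    (coin q h0 h1 b).toReal = if b then q else 1 - q := by
  cases b
  · simp [coin, h1]
  · simp [coin, h0]

namespace SensorModel

variable (M : SensorModel)

/-- The one-step expectation of `f`, expanded over the energy arrival and the next request. -/
theorem expVal_step (s : SysState M) (a : Bool) {f : SysState M → ℝ} {K : ℝ}
    (hf : ∀ x, |f x| ≤ K) :
    (M.step s a).expVal f = ∑ r' : Bool, M.reqProb r' *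
      (M.lam * f (M.nextState s a true r') + (1 - M.lam) * f (M.nextState s a false r')) := by
  rw [step, PMF.expVal_bind _ _ hf]
  simp only [PMF.expVal_map _ _ hf, PMF.expVal_fintype, Fintype.sum_bool, coin_toReal, reqProb,
    Function.comp]
  simp
  ring

theorem reqProb_nonneg (r' : Bool) : 0 ≤ M.reqProb r' := by
  have := M.p_nonneg
  have := M.p_le_one
  cases r' <;> simp [reqProb] <;> linarith

theorem sum_reqProb : ∑ r' : Bool, M.reqProb r' = 1 := by
  simp [reqProb]

instance : DecidableEq (SysState M) := Classical.decEq _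

/-- Given battery level and action, the next age and battery knowledge are deterministic; only the
request and the energy arrival are random. The point mass is computed as the expectation of an
indicator. -/
theorem step_toReal (s : SysState M) (a : Bool) (j : Fin (M.B + 1)) (r' : Bool) (D k : ℕ) :
    (M.step s a ⟨j, ⟨r', D, k⟩⟩).toReal =
      if D = M.nextAge s a ∧ k = (if M.sends s.b a then (s.b : ℕ) else s.o.bt) then
        M.reqProb r' *
          (M.lam * (if min ((s.b : ℕ) + 1 - (M.sends s.b a).toNat) M.B = j then 1 else 0) +
          (1 - M.lam) * (if min ((s.b : ℕ) - (M.sends s.b a).toNat) M.B = j then 1 else 0))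
      else 0 := by
  rw [PMF.apply_toReal_eq_expVal, expVal_step M s a (K := 1) (fun x => by split_ifs <;> simp)]
  · have key : ∀ e r'' : Bool,
        (M.nextState s a e r'' = ⟨j, ⟨r', D, k⟩⟩) ↔
          (r'' = r' ∧ (D = M.nextAge s a ∧ k = (if M.sends s.b a then (s.b : ℕ) else s.o.bt)) ∧
            min ((s.b : ℕ) + e.toNat - (M.sends s.b a).toNat) M.B = j) := by
      intro e r''
      simp only [nextState, SysState.mk.injEq, Obs.mk.injEq, Fin.ext_iff]
      constructor
      · rintro ⟨h1, h2, h3, h4⟩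
        exact ⟨h2, ⟨h3.symm, h4.symm⟩, h1⟩
      · rintro ⟨h2, ⟨h3, h4⟩, h1⟩
        exact ⟨h1, h2, h3.symm, h4.symm⟩
    simp only [key]
    by_cases hD : D = M.nextAge s a ∧ k = (if M.sends s.b a then (s.b : ℕ) else s.o.bt)
    · simp only [hD, true_and, and_self, if_true]
      cases r' <;> simp
    · simp [hD]

/-! ### Beliefs under the two actions -/

theorem nextAge_false (s : SysState M) : M.nextAge s false = min (s.o.Δ + 1) M.Δmax := by
  simp [nextAge, sends]

theorem nextAge_true_zero (o : Obs) : M.nextAge ⟨0, o⟩ true = min (o.Δ + 1) M.Δmax := by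
  simp [nextAge, sends]

theorem sends_true_of_ne {i : Fin (M.B + 1)} (hi : i ≠ 0) : M.sends i true = true := by
  have : (i : ℕ) ≠ 0 := fun h => hi (Fin.ext h)
  simp [sends]
  omega

theorem nextAge_true_of_ne {i : Fin (M.B + 1)} (hi : i ≠ 0) (o : Obs) :
    M.nextAge ⟨i, o⟩ true = 1 := by
  simp [nextAge, M.sends_true_of_ne hi, M.one_le_Δmax]

variable {M} in
-- Under idling the observation is independent of the battery level, so the filter only propagates
-- it by `Λmat`.
theorem jointProb_extend_false (φ : Info M) (r' : Bool) (D k : ℕ) :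
    (φ.extend false ⟨r', D, k⟩).jointProb =
      if D = min (φ.obs.Δ + 1) M.Δmax ∧ k = φ.obs.bt then
        M.reqProb r' • M.Λmat.mulVec φ.jointProb else 0 := by
  funext j
  simp only [Info.jointProb, step_toReal, nextAge_false]
  simp only [sends, Bool.false_and, Bool.false_eq_true, if_false, Bool.toNat_false, Nat.sub_zero]
  by_cases h : D = min (φ.obs.Δ + 1) M.Δmax ∧ k = φ.obs.bt
  · rw [if_pos h]
    simp only [if_pos h, Pi.smul_apply, Matrix.mulVec, dotProduct, smul_eq_mul, Finset.mul_sum]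
    refine Finset.sum_congr rfl fun i _ => ?_
    have hi : (i : ℕ) ≤ M.B := Nat.lt_succ_iff.1 i.2
    have hj : (j : ℕ) ≤ M.B := Nat.lt_succ_iff.1 j.2
    have : M.Λmat j i = M.lam * (if min ((i : ℕ) + 1) M.B = j then 1 else 0) +
          (1 - M.lam) * (if min (i : ℕ) M.B = j then 1 else 0) := by
      simp only [Λmat, min_eq_left hi]
      split_ifs <;> first | omega | ring
    rw [this]
    ring
  · simp [h]

variable {M} in
-- A failure comes only from level 0, and a success from level `i` records `i`, so each outcome
-- contributes a multiple of one `ρ`. The outcomes are added, not separated by cases, because their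
-- observations can coincide when `Δmax = 1`.
theorem jointProb_extend_true (φ : Info M) (r' : Bool) (D k : ℕ) :
    (φ.extend true ⟨r', D, k⟩).jointProb =
      (if D = min (φ.obs.Δ + 1) M.Δmax ∧ k = φ.obs.bt then
        (M.reqProb r' * φ.jointProb 0) • M.ρ 0 else 0) +
      ∑ i ∈ Finset.univ.erase (0 : Fin (M.B + 1)), if D = 1 ∧ k = i then
        (M.reqProb r' * φ.jointProb i) • M.ρ i else 0 := by
  funext j
  simp only [Info.jointProb, step_toReal]
  rw [← Finset.add_sum_erase _ _ (Finset.mem_univ (0 : Fin (M.B + 1)))]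
  simp only [Pi.add_apply, Finset.sum_apply]
  have hB := M.one_le_B
  have hj : (j : ℕ) ≤ M.B := Nat.lt_succ_iff.1 j.2
  congr 1
  · rw [nextAge_true_zero]
    have hs : M.sends 0 true = false := by simp [sends]
    simp only [hs, Bool.false_eq_true, if_false, Bool.toNat_false, Nat.sub_zero]
    by_cases h : D = min (φ.obs.Δ + 1) M.Δmax ∧ k = φ.obs.bt
    · rw [if_pos h, if_pos h]
      have : M.ρ 0 j = M.lam * (if min (((0 : Fin (M.B + 1)) : ℕ) + 1) M.B = j then 1 else 0) +
          (1 - M.lam) * (if min ((0 : Fin (M.B + 1)) : ℕ) M.B = j then 1 else 0) := by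
        simp only [ρ, Fin.val_zero, zero_add, Nat.zero_max, Nat.zero_min, min_eq_left hB]
        split_ifs <;> first | omega | ring
      simp only [Pi.smul_apply, smul_eq_mul, this]
      ring
    · simp [h]
  · refine Finset.sum_congr rfl fun i hi => ?_
    have hi0 : i ≠ 0 := (Finset.mem_erase.1 hi).1
    have hi1 : (i : ℕ) ≠ 0 := fun h => hi0 (Fin.ext h)
    have hiB : (i : ℕ) ≤ M.B := Nat.lt_succ_iff.1 i.2
    rw [M.nextAge_true_of_ne hi0]
    simp only [M.sends_true_of_ne hi0, if_true, Bool.toNat_true]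
    by_cases h : D = 1 ∧ k = i
    · rw [if_pos h, if_pos h]
      have : M.ρ i j = M.lam * (if min ((i : ℕ) + 1 - 1) M.B = j then 1 else 0) +
          (1 - M.lam) * (if min ((i : ℕ) - 1) M.B = j then 1 else 0) := by
        simp only [ρ]
        split_ifs <;> first | omega | ring
      simp only [Pi.smul_apply, smul_eq_mul, this]
      ring
    · simp [h]

end SensorModel

end

noncomputable section

namespace SensorModel

variable (M : SensorModel)

/-! ### The transition kernels of the battery belief -/

theorem Λmat_nonneg (i j : Fin (M.B + 1)) : 0 ≤ M.Λmat i j := by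
  have := M.lam_nonneg
  have := M.lam_le_one
  simp only [Λmat]
  split_ifs <;> linarith

theorem ρ_nonneg (j : ℕ) (i : Fin (M.B + 1)) : 0 ≤ M.ρ j i := by
  have := M.lam_nonneg
  have := M.lam_le_one
  simp only [ρ]
  split_ifs <;> linarith

/-- Column `j` is the law of the level after one possible arrival. Arbitrary test functions `c` let
one formula serve total mass, mean, tail probabilities and the stochastic order. -/
theorem sum_Λmat_mul (j : Fin (M.B + 1)) (c : ℕ → ℝ) :
    ∑ i, M.Λmat i j * c i = (1 - M.lam) * c j + M.lam * c (min ((j : ℕ) + 1) M.B) := by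
  have hj : (j : ℕ) ≤ M.B := Nat.lt_succ_iff.1 j.2
  have h : ∀ i : Fin (M.B + 1), M.Λmat i j * c i =
      (if i = j then (1 - M.lam) * c j else 0) +
      (if i = ⟨min ((j : ℕ) + 1) M.B, by omega⟩ then M.lam * c (min ((j : ℕ) + 1) M.B) else 0) := by
    intro i
    simp only [Λmat, Fin.ext_iff]
    by_cases h1 : (i : ℕ) = j
    · by_cases h2 : (j : ℕ) = M.B
      · have h3 : (i : ℕ) = min ((j : ℕ) + 1) M.B := by omega
        rw [if_pos h1, if_pos h2, if_pos h1, if_pos h3, ← h3, h1]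
        ring
      · have h3 : (i : ℕ) ≠ min ((j : ℕ) + 1) M.B := by omega
        rw [if_pos h1, if_neg h2, if_pos h1, if_neg h3, h1]
        ring
    · by_cases h2 : (i : ℕ) = j + 1
      · have h3 : (i : ℕ) = min ((j : ℕ) + 1) M.B := by omega
        rw [if_neg h1, if_pos h2, if_neg h1, if_pos h3, ← h3]
        ring
      · have h3 : (i : ℕ) ≠ min ((j : ℕ) + 1) M.B := by omega
        rw [if_neg h1, if_neg h2, if_neg h1, if_neg h3]
        ring
  rw [Finset.sum_congr rfl fun i _ => h i, Finset.sum_add_distrib]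
  simp

theorem sum_mulVec_mul (β : Fin (M.B + 1) → ℝ) (c : ℕ → ℝ) :
    ∑ i, M.Λmat.mulVec β i * c i =
      ∑ j, β j * ((1 - M.lam) * c j + M.lam * c (min ((j : ℕ) + 1) M.B)) := by
  simp only [← sum_Λmat_mul, Matrix.mulVec, dotProduct, Finset.sum_mul, Finset.mul_sum]
  rw [Finset.sum_comm]
  exact Finset.sum_congr rfl fun j _ => Finset.sum_congr rfl fun i _ => by ring

theorem sum_ρ_mul {j : ℕ} (hj : j ≤ M.B) (c : ℕ → ℝ) :
    ∑ i, M.ρ j i * c i = (1 - M.lam) * c (max j 1 - 1) + M.lam * c (max j 1) := by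
  have hB := M.one_le_B
  have h : ∀ i : Fin (M.B + 1), M.ρ j i * c i =
      (if i = ⟨max j 1 - 1, by omega⟩ then (1 - M.lam) * c (max j 1 - 1) else 0) +
      (if i = ⟨max j 1, by omega⟩ then M.lam * c (max j 1) else 0) := by
    intro i
    simp only [ρ, Fin.ext_iff]
    by_cases h1 : (i : ℕ) = max j 1 - 1
    · have h2 : (i : ℕ) ≠ max j 1 := by omega
      rw [if_pos h1, if_pos h1, if_neg h2, ← h1]
      ring
    · by_cases h2 : (i : ℕ) = max j 1
      · rw [if_neg h1, if_neg h1, if_pos h2, if_pos h2, ← h2]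
        ring
      · rw [if_neg h1, if_neg h1, if_neg h2, if_neg h2]
        ring
  rw [Finset.sum_congr rfl fun i _ => h i, Finset.sum_add_distrib]
  simp

theorem sum_mulVec (β : Fin (M.B + 1) → ℝ) : ∑ i, M.Λmat.mulVec β i = ∑ j, β j := by
  simpa using M.sum_mulVec_mul β (fun _ => 1)

theorem sum_ρ {j : ℕ} (hj : j ≤ M.B) : ∑ i, M.ρ j i = 1 := by
  simpa using M.sum_ρ_mul hj (fun _ => 1)

theorem mulVec_nonneg {β : Fin (M.B + 1) → ℝ} (h : ∀ j, 0 ≤ β j) (i : Fin (M.B + 1)) :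
    0 ≤ M.Λmat.mulVec β i := by
  simp only [Matrix.mulVec, dotProduct]
  exact Finset.sum_nonneg fun j _ => mul_nonneg (M.Λmat_nonneg i j) (h j)

theorem idle_mem_Z {z : BeliefState M} (hz : z ∈ M.Z) (r' : Bool) :
    (⟨M.Λmat.mulVec z.β, ⟨r', min (z.o.Δ + 1) M.Δmax, z.o.bt⟩⟩ : BeliefState M) ∈ M.Z := by
  obtain ⟨⟨h0, h1⟩, ⟨h2, h3⟩, h4⟩ := hz
  have := M.one_le_Δmax
  exact ⟨⟨M.mulVec_nonneg h0, by rw [M.sum_mulVec, h1]⟩,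
    ⟨⟨by simp only; omega, by simp only; omega⟩, h4⟩⟩

theorem fail_mem_Z {z : BeliefState M} (hz : z ∈ M.Z) (r' : Bool) :
    (⟨M.ρ 0, ⟨r', min (z.o.Δ + 1) M.Δmax, z.o.bt⟩⟩ : BeliefState M) ∈ M.Z := by
  obtain ⟨-, ⟨h2, h3⟩, h4⟩ := hz
  have := M.one_le_Δmax
  exact ⟨⟨M.ρ_nonneg 0, M.sum_ρ (Nat.zero_le _)⟩,
    ⟨⟨by simp only; omega, by simp only; omega⟩, h4⟩⟩

theorem success_mem_Z {j : ℕ} (h1 : 1 ≤ j) (hj : j ≤ M.B) (r' : Bool) :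
    (⟨M.ρ j, ⟨r', 1, j⟩⟩ : BeliefState M) ∈ M.Z :=
  ⟨⟨M.ρ_nonneg j, M.sum_ρ hj⟩, ⟨⟨le_rfl, M.one_le_Δmax⟩, ⟨h1, hj⟩⟩⟩

theorem one_le_of_mem_erase {j : Fin (M.B + 1)} (hj : j ∈ Finset.univ.erase 0) : 1 ≤ (j : ℕ) := by
  have h : j ≠ 0 := (Finset.mem_erase.1 hj).1
  have : (j : ℕ) ≠ 0 := fun h' => h (Fin.ext h')
  omega

theorem le_B (j : Fin (M.B + 1)) : (j : ℕ) ≤ M.B := Nat.lt_succ_iff.1 j.2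

theorem reqProb_true : M.reqProb true = M.p := by simp [reqProb]

theorem reqProb_false : M.reqProb false = 1 - M.p := by simp [reqProb]

/-! ### Monotonicity of the action values -/

theorem Q_eq (h : BeliefState M → ℝ) (z : BeliefState M) (a : Bool) :
    M.Q h z a = if a then
      (z.o.r.toNat : ℝ) * (z.β 0 * (min (z.o.Δ + 1) M.Δmax : ℕ) + (1 - z.β 0)) +
        z.β 0 * ∑ r' : Bool, M.reqProb r' *
          h ⟨M.ρ 0, ⟨r', min (z.o.Δ + 1) M.Δmax, z.o.bt⟩⟩ +
        ∑ j ∈ Finset.univ.erase (0 : Fin (M.B + 1)), z.β j *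
          ∑ r' : Bool, M.reqProb r' * h ⟨M.ρ j, ⟨r', 1, j⟩⟩
      else (z.o.r.toNat : ℝ) * (min (z.o.Δ + 1) M.Δmax : ℕ) +
        ∑ r' : Bool, M.reqProb r' *
          h ⟨M.Λmat.mulVec z.β, ⟨r', min (z.o.Δ + 1) M.Δmax, z.o.bt⟩⟩ := by
  cases a
  · simp [Q, Q0]
  · simp only [Q, Q1, if_true, Fintype.sum_bool, reqProb_true, reqProb_false]

theorem sum_reqProb_le {f g : Bool → ℝ} (h : ∀ r', f r' ≤ g r') :
    ∑ r', M.reqProb r' * f r' ≤ ∑ r', M.reqProb r' * g r' :=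
  Finset.sum_le_sum fun r' _ => mul_le_mul_of_nonneg_left (h r') (M.reqProb_nonneg r')

theorem sum_reqProb_add (f : Bool → ℝ) (c : ℝ) :
    ∑ r', M.reqProb r' * (f r' + c) = ∑ r', M.reqProb r' * f r' + c := by
  simp only [mul_add, Finset.sum_add_distrib, ← Finset.sum_mul, M.sum_reqProb, one_mul]

theorem Q_mono {h h' : BeliefState M → ℝ} (hh : ∀ z ∈ M.Z, h z ≤ h' z) {z : BeliefState M}
    (hz : z ∈ M.Z) (a : Bool) : M.Q h z a ≤ M.Q h' z a := by
  rw [Q_eq, Q_eq]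
  cases a
  · simp only [Bool.false_eq_true, if_false]
    refine add_le_add le_rfl ?_
    exact M.sum_reqProb_le fun r' => hh _ (M.idle_mem_Z hz r')
  · simp only [if_true]
    refine add_le_add (add_le_add le_rfl (mul_le_mul_of_nonneg_left ?_ (hz.1.1 0))) ?_
    · exact M.sum_reqProb_le fun r' => hh _ (M.fail_mem_Z hz r')
    · refine Finset.sum_le_sum fun j hj => mul_le_mul_of_nonneg_left ?_ (hz.1.1 j)
      exact M.sum_reqProb_le fun r' =>
        hh _ (M.success_mem_Z (M.one_le_of_mem_erase hj) (M.le_B j) r')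

theorem add_sum_erase_of_mem_Z {z : BeliefState M} (hz : z ∈ M.Z) :
    z.β 0 + ∑ j ∈ Finset.univ.erase (0 : Fin (M.B + 1)), z.β j = 1 := by
  rw [Finset.add_sum_erase _ _ (Finset.mem_univ _)]
  exact hz.1.2

/-- The continuation weights in `Q` sum to one, as `z.β` is a probability vector. -/
theorem Q_add_const (h : BeliefState M → ℝ) (c : ℝ) {z : BeliefState M} (hz : z ∈ M.Z)
    (a : Bool) : M.Q (fun y => h y + c) z a = M.Q h z a + c := by
  rw [Q_eq, Q_eq]
  cases a
  · simp only [Bool.false_eq_true, if_false]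
    rw [M.sum_reqProb_add, add_assoc]
  · have hs := M.add_sum_erase_of_mem_Z hz
    simp only [if_true, M.sum_reqProb_add]
    simp only [mul_add _ _ c, Finset.sum_add_distrib, ← Finset.sum_mul]
    linear_combination c * hs

theorem β_le_one {z : BeliefState M} (hz : z ∈ M.Z) (j : Fin (M.B + 1)) : z.β j ≤ 1 := by
  rw [← hz.1.2]
  exact Finset.single_le_sum (fun i _ => hz.1.1 i) (Finset.mem_univ j)

/-! ### Expectations over information states -/

/-- The sum of `F` over the admissible observations. -/
def obsSum (F : Obs → ℝ) : ℝ :=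
  ∑ r' : Bool, ∑ D ∈ Finset.Icc 1 M.Δmax, ∑ k ∈ Finset.Icc 1 M.B, F ⟨r', D, k⟩

theorem obsSum_mono {F G : Obs → ℝ} (h : ∀ o, M.ValidObs o → F o ≤ G o) :
    M.obsSum F ≤ M.obsSum G := by
  refine Finset.sum_le_sum fun r' _ => Finset.sum_le_sum fun D hD =>
    Finset.sum_le_sum fun k hk => h _ ⟨?_, ?_⟩
  · exact Finset.mem_Icc.1 hD
  · exact Finset.mem_Icc.1 hk

theorem obsSum_add (F G : Obs → ℝ) : M.obsSum (fun o => F o + G o) = M.obsSum F + M.obsSum G := by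
  simp only [obsSum, Finset.sum_add_distrib]

theorem obsSum_mul (c : ℝ) (F : Obs → ℝ) : M.obsSum (fun o => c * F o) = c * M.obsSum F := by
  simp only [obsSum, Finset.mul_sum]

theorem obsSum_sum {ι : Type*} (s : Finset ι) (F : ι → Obs → ℝ) :
    M.obsSum (fun o => ∑ i ∈ s, F i o) = ∑ i ∈ s, M.obsSum (F i) := by
  simp only [obsSum]
  rw [Finset.sum_comm (s := s)]
  refine Finset.sum_congr rfl fun r' _ => ?_
  rw [Finset.sum_comm (s := s)]
  refine Finset.sum_congr rfl fun D _ => ?_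
  rw [Finset.sum_comm (s := s)]

/-- The sum of the unnormalized quantity `g` over the information states at time `t`, weighted by
the probabilities with which the policy `σ` takes the recorded actions. -/
def infoSum (σ : M.InfoPolicy) (z₀ : BeliefState M) : ℕ → (Info M → ℝ) → ℝ
  | 0, g => g (.start z₀)
  | t + 1, g => infoSum σ z₀ t fun φ =>
      ∑ a, (σ φ a).toReal * M.obsSum fun o => g (φ.extend a o)

/-- Information states with a nonnegative joint law and a valid last observation. -/
def Admissible (φ : Info M) : Prop := (∀ j, 0 ≤ φ.jointProb j) ∧ M.ValidObs φ.obs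

variable {M}

theorem Admissible.extend {φ : Info M} (h : M.Admissible φ) (a : Bool) {o : Obs}
    (ho : M.ValidObs o) : M.Admissible (φ.extend a o) :=
  ⟨fun _ => Finset.sum_nonneg fun i _ => mul_nonneg (h.1 i) ENNReal.toReal_nonneg, ho⟩

theorem admissible_start {z₀ : BeliefState M} (hz : z₀ ∈ M.Z) : M.Admissible (.start z₀) :=
  ⟨hz.1.1, hz.2⟩

theorem infoSum_mono (σ : M.InfoPolicy) {z₀ : BeliefState M} (hz : z₀ ∈ M.Z) (t : ℕ)
    {g g' : Info M → ℝ} (h : ∀ φ, M.Admissible φ → g φ ≤ g' φ) :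
    M.infoSum σ z₀ t g ≤ M.infoSum σ z₀ t g' := by
  induction t generalizing g g' with
  | zero => exact h _ (admissible_start hz)
  | succ t ih =>
    refine ih fun φ hφ => Finset.sum_le_sum fun a _ => ?_
    exact mul_le_mul_of_nonneg_left
      (M.obsSum_mono fun o ho => h _ (hφ.extend a ho)) ENNReal.toReal_nonneg

theorem infoSum_congr (σ : M.InfoPolicy) {z₀ : BeliefState M} (hz : z₀ ∈ M.Z) (t : ℕ)
    {g g' : Info M → ℝ} (h : ∀ φ, M.Admissible φ → g φ = g' φ) :
    M.infoSum σ z₀ t g = M.infoSum σ z₀ t g' :=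
  le_antisymm (infoSum_mono σ hz t fun φ hφ => (h φ hφ).le)
    (infoSum_mono σ hz t fun φ hφ => (h φ hφ).ge)

theorem infoSum_add (σ : M.InfoPolicy) (z₀ : BeliefState M) (t : ℕ) (g g' : Info M → ℝ) :
    M.infoSum σ z₀ t (fun φ => g φ + g' φ) = M.infoSum σ z₀ t g + M.infoSum σ z₀ t g' := by
  induction t generalizing g g' with
  | zero => rfl
  | succ t ih =>
    simp only [infoSum]
    rw [← ih]
    simp only [obsSum_add, mul_add, Finset.sum_add_distrib]

theorem infoSum_const_mul (σ : M.InfoPolicy) (z₀ : BeliefState M) (t : ℕ) (c : ℝ)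
    (g : Info M → ℝ) : M.infoSum σ z₀ t (fun φ => c * g φ) = c * M.infoSum σ z₀ t g := by
  induction t generalizing g with
  | zero => rfl
  | succ t ih =>
    simp only [infoSum]
    rw [← ih]
    simp only [obsSum_mul, Finset.mul_sum]
    congr 1
    funext φ
    exact Finset.sum_congr rfl fun a _ => by ring

/-- The one-step expectation of `f` is a sum over the next observation and battery level. -/
theorem expVal_step_eq_obsSum {i : Fin (M.B + 1)} {o : Obs} (ho : M.ValidObs o) (a : Bool)
    (f : Fin (M.B + 1) → Obs → ℝ) {K : ℝ} (hf : ∀ j o', |f j o'| ≤ K) :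
    (M.step ⟨i, o⟩ a).expVal (fun s' => f s'.b s'.o) =
      M.obsSum fun o' => ∑ j, (M.step ⟨i, o⟩ a ⟨j, o'⟩).toReal * f j o' := by
  rw [M.expVal_step _ _ (fun x => hf x.b x.o)]
  simp only [obsSum, step_toReal]
  refine Finset.sum_congr rfl fun r' _ => ?_
  have hΔ := M.one_le_Δmax
  have hi := M.le_B i
  have h1 : M.nextAge ⟨i, o⟩ a ∈ Finset.Icc 1 M.Δmax := by
    simp only [nextAge, Finset.mem_Icc]
    omega
  have h2 : (if M.sends i a then (i : ℕ) else o.bt) ∈ Finset.Icc 1 M.B := by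
    rw [Finset.mem_Icc]
    split_ifs with h
    · simp only [sends, Bool.and_eq_true, decide_eq_true_eq] at h
      omega
    · exact ho.2
  rw [Finset.sum_eq_single_of_mem _ h1, Finset.sum_eq_single_of_mem _ h2]
  · simp only [true_and, if_true, mul_add, add_mul, Finset.sum_add_distrib]
    have key : ∀ e : Bool, ∀ c : ℝ, ∑ j : Fin (M.B + 1),
        M.reqProb r' * (c * if min ((i : ℕ) + e.toNat - (M.sends i a).toNat) M.B = j then 1 else 0)
          * f j ⟨r', M.nextAge ⟨i, o⟩ a, if M.sends i a then (i : ℕ) else o.bt⟩ =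
        M.reqProb r' * (c * f (M.nextState ⟨i, o⟩ a e r').b (M.nextState ⟨i, o⟩ a e r').o) := by
      intro e c
      rw [Finset.sum_eq_single_of_mem (M.nextState ⟨i, o⟩ a e r').b (Finset.mem_univ _)]
      · simp only [nextState, if_true]
        ring
      · intro j _ hj
        have : ¬ min ((i : ℕ) + e.toNat - (M.sends i a).toNat) M.B = j := by
          intro h
          exact hj (Fin.ext h.symm)
        simp [this]
    have e1 := key true M.lam
    have e2 := key false (1 - M.lam)
    simp only [Bool.toNat_true, Bool.toNat_false, add_zero] at e1 e2
    rw [e1, e2]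
  · intro k _ hk
    simp [hk]
  · intro D _ hD
    simp [hD]

/-- The expectation of `f` over the battery level and the information state at time `t`. -/
theorem sum_expVal_law (σ : M.InfoPolicy) {z₀ : BeliefState M} (hz : z₀ ∈ M.Z) (t : ℕ)
    {f : Fin (M.B + 1) × Info M → ℝ} {K : ℝ} (hf : ∀ x, |f x| ≤ K) :
    ∑ b₀, z₀.β b₀ * (M.law σ z₀ b₀ t).expVal f =
      M.infoSum σ z₀ t fun φ => ∑ j, φ.jointProb j * f (j, φ) := by
  induction t generalizing f with
  | zero => simp only [law, PMF.expVal_pure, infoSum, Info.jointProb]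
  | succ t ih =>
    simp only [law, PMF.expVal_bind _ _ hf, PMF.expVal_map _ _ hf, Function.comp_def]
    -- The law is extended at its last step, so the induction hypothesis is applied to the
    -- conditional expectation of `f` one step ahead.
    rw [ih (f := fun x => (σ x.2).expVal fun a => (M.step ⟨x.1, x.2.obs⟩ a).expVal fun s' =>
      f (s'.b, x.2.extend a s'.o)) fun x => PMF.abs_expVal_le _ fun a =>
        PMF.abs_expVal_le _ fun s' => hf _]
    simp only [infoSum]
    refine infoSum_congr σ hz t fun φ hφ => ?_
    have hstep : ∀ (i : Fin (M.B + 1)) (a : Bool),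
        ((M.step ⟨i, φ.obs⟩ a).expVal fun s' => f (s'.b, φ.extend a s'.o)) =
        M.obsSum fun o' => ∑ j, (M.step ⟨i, φ.obs⟩ a ⟨j, o'⟩).toReal * f (j, φ.extend a o') :=
      fun i a => expVal_step_eq_obsSum hφ.2 a (fun j o' => f (j, φ.extend a o')) fun _ _ => hf _
    simp only [hstep, PMF.expVal_fintype, Finset.mul_sum, ← obsSum_mul, ← obsSum_sum,
      Info.jointProb, Finset.sum_mul]
    congr 1
    funext o'
    rw [Finset.sum_comm]
    refine Finset.sum_congr rfl fun a _ => ?_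
    rw [Finset.sum_comm]
    exact Finset.sum_congr rfl fun j _ => Finset.sum_congr rfl fun i _ => by ring

theorem abs_cost_le (s : SysState M) (a : Bool) : |M.cost s a| ≤ M.Δmax := by
  have h : M.nextAge s a ≤ M.Δmax := min_le_right _ _
  have h' : (M.nextAge s a : ℝ) ≤ M.Δmax := by exact_mod_cast h
  simp only [cost]
  cases s.o.r <;> simp [h']

theorem expAoI_eq_infoSum (σ : M.InfoPolicy) {z₀ : BeliefState M} (hz : z₀ ∈ M.Z) (t : ℕ) :
    M.expAoI σ z₀ t = M.infoSum σ z₀ t fun φ =>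
      ∑ a, (σ φ a).toReal * ∑ j, φ.jointProb j * M.cost ⟨j, φ.obs⟩ a := by
  have hb : ∀ y : (Fin (M.B + 1) × Info M) × Bool,
      |M.cost ⟨y.1.1, y.1.2.obs⟩ y.2| ≤ M.Δmax := fun y => abs_cost_le _ _
  simp only [expAoI, PMF.expVal_bind _ _ hb, PMF.expVal_map _ _ hb, Function.comp_def]
  rw [sum_expVal_law (f := fun x => (σ x.2).expVal fun a => M.cost ⟨x.1, x.2.obs⟩ a) σ hz t
    fun x => PMF.abs_expVal_le _ fun a => abs_cost_le _ _]
  congr 1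
  funext φ
  simp only [PMF.expVal_fintype, Finset.mul_sum]
  rw [Finset.sum_comm]
  exact Finset.sum_congr rfl fun a _ => Finset.sum_congr rfl fun j _ => by ring

theorem infoSum_sum_jointProb (σ : M.InfoPolicy) {z₀ : BeliefState M} (hz : z₀ ∈ M.Z) (t : ℕ) :
    (M.infoSum σ z₀ t fun φ => ∑ j, φ.jointProb j) = 1 := by
  have h := sum_expVal_law σ hz t (f := fun _ => 1) (K := 1) fun _ => by simp
  simp only [PMF.expVal_const, mul_one] at h
  rw [← h]
  exact hz.1.2

end SensorModel

end

/-! ### The homogeneous extension of `h` and the dynamic programming identity. -/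

noncomputable section

namespace SensorModel

variable {M : SensorModel}

/-- The value of `h` at the belief-state with unnormalized belief `v`, weighted by the mass of `v`. -/
def weighted (h : BeliefState M → ℝ) (v : Fin (M.B + 1) → ℝ) (o : Obs) : ℝ :=
  (∑ j, v j) * h ⟨fun j => v j / ∑ i, v i, o⟩

theorem weighted_zero (h : BeliefState M → ℝ) (o : Obs) : weighted h 0 o = 0 := by
  simp [weighted]

/-- Homogeneity, including `c = 0`, where the normalized belief is meaningless but carries no mass.
-/
theorem weighted_smul (h : BeliefState M → ℝ) (c : ℝ) {w : Fin (M.B + 1) → ℝ}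
    (hw : ∑ j, w j = 1) (o : Obs) : weighted h (c • w) o = c * h ⟨w, o⟩ := by
  have hs : ∑ j, (c • w) j = c := by
    simp only [Pi.smul_apply, smul_eq_mul, ← Finset.mul_sum, hw, mul_one]
  simp only [weighted, hs]
  rcases eq_or_ne c 0 with rfl | hc
  · simp
  · congr 3
    funext j
    simp only [Pi.smul_apply, smul_eq_mul]
    field_simp

theorem weighted_jointProb (h : BeliefState M → ℝ) (φ : Info M) :
    weighted h φ.jointProb φ.obs = (∑ j, φ.jointProb j) * h φ.beliefState := rfl

theorem beliefState_mem_Z {φ : Info M} (hφ : M.Admissible φ) (hN : ∑ j, φ.jointProb j ≠ 0) :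
    φ.beliefState ∈ M.Z := by
  refine ⟨⟨fun j => div_nonneg (hφ.1 j) (Finset.sum_nonneg fun i _ => hφ.1 i), ?_⟩, hφ.2⟩
  simp only [Info.beliefState, Info.belief, ← Finset.sum_div]
  exact div_self hN

theorem obsSum_ite_eq {D k : ℕ} (hD : D ∈ Finset.Icc 1 M.Δmax) (hk : k ∈ Finset.Icc 1 M.B)
    (F : Bool → ℝ) :
    M.obsSum (fun o => if o.Δ = D ∧ o.bt = k then F o.r else 0) = ∑ r', F r' := by
  refine Finset.sum_congr rfl fun r' _ => ?_
  rw [Finset.sum_eq_single_of_mem D hD, Finset.sum_eq_single_of_mem k hk]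
  · simp
  · intro k' _ h
    simp [h]
  · intro D' _ h
    simp [h]

theorem nextAge_mem (o : Obs) :
    min (o.Δ + 1) M.Δmax ∈ Finset.Icc 1 M.Δmax := by
  have := M.one_le_Δmax
  rw [Finset.mem_Icc]
  omega

theorem obsSum_weighted_false (h : BeliefState M → ℝ) {φ : Info M} (hφ : M.Admissible φ)
    (hN : ∑ j, φ.jointProb j ≠ 0) :
    M.obsSum (fun o => weighted h (φ.extend false o).jointProb o) =
      (∑ j, φ.jointProb j) * ∑ r', M.reqProb r' *
        h ⟨M.Λmat.mulVec φ.belief, ⟨r', min (φ.obs.Δ + 1) M.Δmax, φ.obs.bt⟩⟩ := by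
  have hZ := beliefState_mem_Z hφ hN
  have hb : φ.jointProb = (∑ j, φ.jointProb j) • φ.belief := by
    funext j
    simp only [Pi.smul_apply, smul_eq_mul, Info.belief]
    field_simp
  have h1 : ∑ i, M.Λmat.mulVec φ.belief i = 1 := by
    rw [M.sum_mulVec]
    exact hZ.1.2
  rw [Finset.mul_sum, ← obsSum_ite_eq (nextAge_mem _) (Finset.mem_Icc.2 hφ.2.2)]
  congr 1
  funext ⟨r', D, k⟩
  rw [jointProb_extend_false]
  by_cases hc : D = min (φ.obs.Δ + 1) M.Δmax ∧ k = φ.obs.bt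
  · rw [if_pos hc, if_pos hc]
    conv_lhs => rw [hb, Matrix.mulVec_smul, smul_smul]
    rw [weighted_smul _ _ h1, hc.1, hc.2]
    ring
  · rw [if_neg hc, if_neg hc, weighted_zero]

/-- With `2 ≤ Δmax` a failure leaves an age of at least 2 and a success an age of 1. Each
observation thus receives at most one term of `jointProb_extend_true`, and homogeneity applies to
that term. -/
theorem obsSum_weighted_true (hΔ : 2 ≤ M.Δmax) (h : BeliefState M → ℝ) {φ : Info M}
    (hφ : M.Admissible φ) :
    M.obsSum (fun o => weighted h (φ.extend true o).jointProb o) =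
      φ.jointProb 0 * ∑ r', M.reqProb r' *
        h ⟨M.ρ 0, ⟨r', min (φ.obs.Δ + 1) M.Δmax, φ.obs.bt⟩⟩ +
      ∑ j ∈ Finset.univ.erase (0 : Fin (M.B + 1)), φ.jointProb j *
        ∑ r', M.reqProb r' * h ⟨M.ρ j, ⟨r', 1, j⟩⟩ := by
  have key : ∀ o : Obs, M.ValidObs o → weighted h (φ.extend true o).jointProb o =
      (if o.Δ = min (φ.obs.Δ + 1) M.Δmax ∧ o.bt = φ.obs.bt then
        φ.jointProb 0 * (M.reqProb o.r *
          h ⟨M.ρ 0, ⟨o.r, min (φ.obs.Δ + 1) M.Δmax, φ.obs.bt⟩⟩) else 0) +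
      ∑ j ∈ Finset.univ.erase (0 : Fin (M.B + 1)), if o.Δ = 1 ∧ o.bt = j then
        φ.jointProb j * (M.reqProb o.r * h ⟨M.ρ j, ⟨o.r, 1, j⟩⟩) else 0 := by
    rintro ⟨r', D, k⟩ ho
    rw [jointProb_extend_true]
    have h1 : 1 ≤ φ.obs.Δ := hφ.2.1.1
    by_cases hc : D = min (φ.obs.Δ + 1) M.Δmax ∧ k = φ.obs.bt
    · simp only [hc, and_self, if_true]
      have hD' : min (φ.obs.Δ + 1) M.Δmax ≠ 1 := by omega
      simp only [hD', false_and, if_false, Finset.sum_const_zero, add_zero]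
      rw [weighted_smul _ _ (M.sum_ρ (Nat.zero_le _))]
      ring
    · simp only [if_neg hc, zero_add]
      by_cases hD : D = 1
      · have hk : (⟨k, by have := ho.2.2; simp only at this; omega⟩ : Fin (M.B + 1)) ∈
            Finset.univ.erase 0 := by
          have h2 := ho.2.1
          simp only at h2
          simp only [Finset.mem_erase, Finset.mem_univ, and_true, ne_eq, Fin.ext_iff,
            Fin.val_zero]
          omega
        rw [Finset.sum_eq_single_of_mem _ hk, Finset.sum_eq_single_of_mem _ hk]
        · simp only [hD, and_self, if_true]
          rw [weighted_smul _ _ (M.sum_ρ ho.2.2)]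
          ring
        · intro j _ hj
          have : k ≠ j := fun h' => hj (Fin.ext h'.symm)
          simp [this]
        · intro j _ hj
          have : k ≠ j := fun h' => hj (Fin.ext h'.symm)
          simp [this]
      · simp only [hD, false_and, if_false, Finset.sum_const_zero]
        exact weighted_zero _ _
  have hcongr : M.obsSum (fun o => weighted h (φ.extend true o).jointProb o) = M.obsSum _ :=
    le_antisymm (M.obsSum_mono fun o ho => (key o ho).le)
      (M.obsSum_mono fun o ho => (key o ho).ge)
  rw [hcongr, obsSum_add, obsSum_sum,
    obsSum_ite_eq (nextAge_mem _) (Finset.mem_Icc.2 hφ.2.2)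
      (fun r' => φ.jointProb 0 * (M.reqProb r' *
          h ⟨M.ρ 0, ⟨r', min (φ.obs.Δ + 1) M.Δmax, φ.obs.bt⟩⟩)), Finset.mul_sum]
  congr 1
  refine Finset.sum_congr rfl fun j hj => ?_
  rw [obsSum_ite_eq (Finset.mem_Icc.2 ⟨le_rfl, M.one_le_Δmax⟩)
      (Finset.mem_Icc.2 ⟨M.one_le_of_mem_erase hj, M.le_B j⟩)
      (fun r' => φ.jointProb j * (M.reqProb r' * h ⟨M.ρ j, ⟨r', 1, j⟩⟩)), Finset.mul_sum]

/-- The total of the current cost and of `h` at the next belief-state is the action value. -/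
theorem sum_cost_add_obsSum (hΔ : 2 ≤ M.Δmax) (h : BeliefState M → ℝ) {φ : Info M}
    (hφ : M.Admissible φ) (a : Bool) :
    ∑ j, φ.jointProb j * M.cost ⟨j, φ.obs⟩ a +
      M.obsSum (fun o => weighted h (φ.extend a o).jointProb o) =
    (∑ j, φ.jointProb j) * M.Q h φ.beliefState a := by
  -- On a null history the belief is a division by zero; the zero mass makes both sides vanish.
  by_cases hN : ∑ j, φ.jointProb j = 0
  · have h0 : ∀ j, φ.jointProb j = 0 := fun j =>
      (Finset.sum_eq_zero_iff_of_nonneg fun i _ => hφ.1 i).1 hN j (Finset.mem_univ j)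
    have h1 : ∀ o, (φ.extend a o).jointProb = 0 := by
      intro o
      funext j
      simp [Info.jointProb, h0]
    simp [h0, h1, weighted_zero, obsSum]
  · have hb : ∀ j, φ.jointProb j = (∑ j, φ.jointProb j) * φ.beliefState.β j := by
      intro j
      simp only [Info.beliefState, Info.belief]
      field_simp
    have hs := M.add_sum_erase_of_mem_Z (beliefState_mem_Z hφ hN)
    rw [Q_eq]
    cases a
    · rw [obsSum_weighted_false h hφ hN]
      simp only [cost, nextAge_false, ← Finset.sum_mul, Bool.false_eq_true, if_false]
      simp only [Info.beliefState]
      ring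
    · rw [obsSum_weighted_true hΔ h hφ]
      have hc : ∑ j, φ.jointProb j * M.cost ⟨j, φ.obs⟩ true =
          (φ.obs.r.toNat : ℝ) * (φ.jointProb 0 * (min (φ.obs.Δ + 1) M.Δmax : ℕ) +
            ∑ j ∈ Finset.univ.erase (0 : Fin (M.B + 1)), φ.jointProb j) := by
        rw [← Finset.add_sum_erase _ _ (Finset.mem_univ (0 : Fin (M.B + 1)))]
        simp only [cost, nextAge_true_zero]
        rw [Finset.sum_congr rfl (g := fun j => (φ.obs.r.toNat : ℝ) * φ.jointProb j)]
        · rw [← Finset.mul_sum]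
          ring
        · intro j hj
          rw [M.nextAge_true_of_ne (Finset.mem_erase.1 hj).1]
          push_cast
          ring
      rw [hc]
      set N := ∑ j, φ.jointProb j with hNdef
      simp only [hb, if_true, mul_assoc, ← Finset.mul_sum]
      rw [← sub_eq_of_eq_add' hs.symm]
      simp only [Info.beliefState]
      ring

theorem sum_policy (σ : M.InfoPolicy) (φ : Info M) : ∑ a, (σ φ a).toReal = 1 := by
  have := (σ φ).tsum_toReal
  rwa [tsum_fintype] at this

theorem expAoI_add_infoSum (hΔ : 2 ≤ M.Δmax) (h : BeliefState M → ℝ) (σ : M.InfoPolicy)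
    {z₀ : BeliefState M} (hz : z₀ ∈ M.Z) (t : ℕ) :
    M.expAoI σ z₀ t + M.infoSum σ z₀ (t + 1) (fun φ => weighted h φ.jointProb φ.obs) =
      M.infoSum σ z₀ t fun φ => (∑ j, φ.jointProb j) *
        ∑ a, (σ φ a).toReal * M.Q h φ.beliefState a := by
  rw [expAoI_eq_infoSum σ hz]
  simp only [infoSum]
  rw [← infoSum_add]
  refine infoSum_congr σ hz t fun φ hφ => ?_
  rw [← Finset.sum_add_distrib, Finset.mul_sum]
  refine Finset.sum_congr rfl fun a _ => ?_
  rw [← mul_add]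
  have := sum_cost_add_obsSum hΔ h hφ a
  calc _ = (σ φ a).toReal * ((∑ j, φ.jointProb j) * M.Q h φ.beliefState a) := by
        rw [← this]
        rfl
    _ = _ := by ring

theorem infoSum_const_add_weighted (h : BeliefState M → ℝ) (C : ℝ) (σ : M.InfoPolicy)
    {z₀ : BeliefState M} (hz : z₀ ∈ M.Z) (t : ℕ) :
    (M.infoSum σ z₀ t fun φ => (∑ j, φ.jointProb j) * (C + h φ.beliefState)) =
      C + M.infoSum σ z₀ t (fun φ => weighted h φ.jointProb φ.obs) := by
  have h1 := infoSum_const_mul σ z₀ t C fun φ => ∑ j, φ.jointProb j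
  rw [infoSum_sum_jointProb σ hz, mul_one] at h1
  conv_rhs => enter [1]; rw [← h1]
  rw [← infoSum_add]
  congr 1
  funext φ
  rw [weighted_jointProb]
  ring

/-- The Bellman minimum is below any mixture of the two action values, whatever part of the history
determines the mixture. Hence the bound covers all information policies. -/
theorem le_expAoI_add (hΔ : 2 ≤ M.Δmax) {C : ℝ} {h : BeliefState M → ℝ}
    (hB : M.SolvesBellman C h) (σ : M.InfoPolicy) {z₀ : BeliefState M} (hz : z₀ ∈ M.Z) (t : ℕ) :
    C + M.infoSum σ z₀ t (fun φ => weighted h φ.jointProb φ.obs) ≤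
      M.expAoI σ z₀ t + M.infoSum σ z₀ (t + 1) (fun φ => weighted h φ.jointProb φ.obs) := by
  rw [expAoI_add_infoSum hΔ h σ hz, ← infoSum_const_add_weighted h C σ hz]
  refine infoSum_mono σ hz t fun φ hφ => ?_
  by_cases hN : ∑ j, φ.jointProb j = 0
  · simp [hN]
  refine mul_le_mul_of_nonneg_left ?_ (Finset.sum_nonneg fun j _ => hφ.1 j)
  have hm := hB.2 _ (beliefState_mem_Z hφ hN)
  have hs := sum_policy σ φ
  calc C + h φ.beliefState = ∑ a, (σ φ a).toReal * (C + h φ.beliefState) := by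
        rw [← Finset.sum_mul, hs, one_mul]
    _ ≤ _ := by
        refine Finset.sum_le_sum fun a _ => mul_le_mul_of_nonneg_left ?_ ENNReal.toReal_nonneg
        rw [hm]
        cases a
        · exact min_le_left _ _
        · exact min_le_right _ _

theorem expAoI_add_greedy (hΔ : 2 ≤ M.Δmax) {C : ℝ} {h : BeliefState M → ℝ}
    (hB : M.SolvesBellman C h) {π : BeliefState M → Bool} (hπ : M.IsGreedy h π)
    {z₀ : BeliefState M} (hz : z₀ ∈ M.Z) (t : ℕ) :
    M.expAoI (M.detPolicy π).toInfo z₀ t +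
        M.infoSum (M.detPolicy π).toInfo z₀ (t + 1) (fun φ => weighted h φ.jointProb φ.obs) =
      C + M.infoSum (M.detPolicy π).toInfo z₀ t (fun φ => weighted h φ.jointProb φ.obs) := by
  rw [expAoI_add_infoSum hΔ h _ hz, ← infoSum_const_add_weighted h C _ hz]
  refine infoSum_congr _ hz t fun φ hφ => ?_
  by_cases hN : ∑ j, φ.jointProb j = 0
  · simp [hN]
  have hZ := beliefState_mem_Z hφ hN
  congr 1
  rw [hB.2 _ hZ]
  have hp : ∀ a, ((M.detPolicy π).toInfo φ a).toReal =
      if a = π φ.beliefState then 1 else 0 := by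
    intro a
    simp only [Policy.toInfo, detPolicy, PMF.pure_apply]
    split_ifs <;> simp
  simp only [hp, ite_mul, one_mul, zero_mul, Finset.sum_ite_eq', Finset.mem_univ, if_true]
  have h1 := hπ _ hZ false
  have h2 := hπ _ hZ true
  refine le_antisymm (le_min h1 h2) ?_
  cases π φ.beliefState
  · exact min_le_left _ _
  · exact min_le_right _ _

theorem abs_infoSum_weighted_le {h : BeliefState M → ℝ} {K : ℝ} (hK : ∀ z ∈ M.Z, |h z| ≤ K)
    (σ : M.InfoPolicy) {z₀ : BeliefState M} (hz : z₀ ∈ M.Z) (t : ℕ) :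
    |M.infoSum σ z₀ t (fun φ => weighted h φ.jointProb φ.obs)| ≤ K := by
  have hbound : ∀ φ, M.Admissible φ → |weighted h φ.jointProb φ.obs| ≤ K * ∑ j, φ.jointProb j := by
    intro φ hφ
    rw [weighted_jointProb]
    by_cases hN : ∑ j, φ.jointProb j = 0
    · simp [hN]
    have h0 : 0 ≤ ∑ j, φ.jointProb j := Finset.sum_nonneg fun j _ => hφ.1 j
    rw [abs_mul, abs_of_nonneg h0, mul_comm]
    exact mul_le_mul_of_nonneg_right (hK _ (beliefState_mem_Z hφ hN)) h0
  have h1 : ∀ c : ℝ, (M.infoSum σ z₀ t fun φ => c * ∑ j, φ.jointProb j) = c := by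
    intro c
    rw [infoSum_const_mul, infoSum_sum_jointProb σ hz, mul_one]
  rw [abs_le]
  constructor
  · rw [← h1 (-K)]
    refine infoSum_mono σ hz t fun φ hφ => ?_
    have := (abs_le.1 (hbound φ hφ)).1
    linarith
  · conv_rhs => rw [← h1 K]
    exact infoSum_mono σ hz t fun φ hφ => (abs_le.1 (hbound φ hφ)).2

/-! ### Running averages and telescoping. -/

theorem runningAvg_eq (σ : M.InfoPolicy) (z₀ : BeliefState M) (T : ℕ) :
    M.runningAvg σ z₀ T = (∑ t ∈ Finset.range T, M.expAoI σ z₀ (t + 1)) / T := by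
  rw [runningAvg, one_div, inv_mul_eq_div]
  congr 1
  rw [Finset.range_eq_Ico, Finset.sum_Ico_add' (fun t => M.expAoI σ z₀ t)]
  rfl

theorem tendsto_const_div_nat (C K : ℝ) :
    Tendsto (fun T : ℕ => C + K / (T : ℝ)) atTop (𝓝 C) := by
  simpa using (tendsto_const_div_atTop_nhds_zero_nat K).const_add C

theorem abs_expAoI_le (σ : M.InfoPolicy) {z₀ : BeliefState M} (hz : z₀ ∈ M.Z) (t : ℕ) :
    |M.expAoI σ z₀ t| ≤ M.Δmax := by
  rw [expAoI]
  refine (Finset.abs_sum_le_sum_abs _ _).trans ?_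
  calc _ ≤ ∑ b₀, z₀.β b₀ * (M.Δmax : ℝ) := by
        refine Finset.sum_le_sum fun b _ => ?_
        rw [abs_mul, abs_of_nonneg (hz.1.1 b)]
        exact mul_le_mul_of_nonneg_left (PMF.abs_expVal_le _ fun y => abs_cost_le _ _) (hz.1.1 b)
    _ = M.Δmax := by rw [← Finset.sum_mul, hz.1.2, one_mul]

theorem abs_runningAvg_le (σ : M.InfoPolicy) {z₀ : BeliefState M} (hz : z₀ ∈ M.Z) (T : ℕ) :
    |M.runningAvg σ z₀ T| ≤ M.Δmax := by
  rw [runningAvg_eq, abs_div, Nat.abs_cast]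
  refine div_le_of_le_mul₀ (Nat.cast_nonneg _) (Nat.cast_nonneg _) ?_
  refine (Finset.abs_sum_le_sum_abs _ _).trans ?_
  refine (Finset.sum_le_sum fun t _ => abs_expAoI_le σ hz (t + 1)).trans ?_
  simp [mul_comm]

theorem isBoundedUnder_runningAvg (σ : M.InfoPolicy) {z₀ : BeliefState M} (hz : z₀ ∈ M.Z) :
    IsBoundedUnder (· ≤ ·) atTop (fun T => M.runningAvg σ z₀ T) ∧
      IsBoundedUnder (· ≥ ·) atTop (fun T => M.runningAvg σ z₀ T) :=
  ⟨isBoundedUnder_of ⟨M.Δmax, fun T => (abs_le.1 (abs_runningAvg_le σ hz T)).2⟩,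
    isBoundedUnder_of ⟨-M.Δmax, fun T => (abs_le.1 (abs_runningAvg_le σ hz T)).1⟩⟩

/-- Lower bound on the running average from a potential argument. -/
theorem le_runningAvg_of_potential {σ : M.InfoPolicy} {z₀ : BeliefState M} {C K : ℝ} {H : ℕ → ℝ}
    (hH : ∀ t, |H t| ≤ K) (hstep : ∀ t, C + H t ≤ M.expAoI σ z₀ t + H (t + 1)) {T : ℕ}
    (hT : 0 < T) : C + -(2 * K) / T ≤ M.runningAvg σ z₀ T := by
  -- The average starts at slot 1, so the potential telescopes from `H 1` to `H (T + 1)`; bounding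
  -- both ends gives `2 * K`.
  have hsum : ∀ T : ℕ, T * C + H 1 ≤ ∑ t ∈ Finset.range T, M.expAoI σ z₀ (t + 1) + H (T + 1) := by
    intro T
    induction T with
    | zero => simp
    | succ T ih =>
      rw [Finset.sum_range_succ]
      have := hstep (T + 1)
      push_cast
      linarith
  have hT' : (0 : ℝ) < T := by exact_mod_cast hT
  rw [runningAvg_eq, le_div_iff₀ hT', add_mul, div_mul_cancel₀ _ hT'.ne']
  have h1 := (abs_le.1 (hH 1)).1
  have h2 := (abs_le.1 (hH (T + 1))).2
  have := hsum T
  linarith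

/-- Upper bound on the running average from a potential argument. -/
theorem runningAvg_le_of_potential {σ : M.InfoPolicy} {z₀ : BeliefState M} {C K : ℝ} {H : ℕ → ℝ}
    (hH : ∀ t, |H t| ≤ K) (hstep : ∀ t, M.expAoI σ z₀ t + H (t + 1) ≤ C + H t) {T : ℕ}
    (hT : 0 < T) : M.runningAvg σ z₀ T ≤ C + (2 * K) / T := by
  have hsum : ∀ T : ℕ, ∑ t ∈ Finset.range T, M.expAoI σ z₀ (t + 1) + H (T + 1) ≤ T * C + H 1 := by
    intro T
    induction T with
    | zero => simp
    | succ T ih =>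
      rw [Finset.sum_range_succ]
      have := hstep (T + 1)
      push_cast
      linarith
  have hT' : (0 : ℝ) < T := by exact_mod_cast hT
  rw [runningAvg_eq, div_le_iff₀ hT', add_mul, div_mul_cancel₀ _ hT'.ne']
  have h1 := (abs_le.1 (hH 1)).2
  have h2 := (abs_le.1 (hH (T + 1))).1
  have := hsum T
  linarith

/-! ### The degenerate age bound `Δmax = 1` -/

theorem cost_of_Δmax_eq_one (hΔ : M.Δmax = 1) (s : SysState M) (a : Bool) :
    M.cost s a = s.o.r.toNat := by
  have : M.nextAge s a = 1 := by
    simp only [nextAge, hΔ]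
    omega
  simp [cost, this]

/-- The age is always 1, so the cost is the current request. Slot 0 is excluded because its request
is prescribed by `z₀`. -/
theorem expAoI_succ_of_Δmax_eq_one (hΔ : M.Δmax = 1) (σ : M.InfoPolicy) {z₀ : BeliefState M}
    (hz : z₀ ∈ M.Z) (t : ℕ) : M.expAoI σ z₀ (t + 1) = M.p := by
  have hr : ∀ s : SysState M, |(s.o.r.toNat : ℝ)| ≤ 1 := by
    intro s
    cases s.o.r <;> simp
  have hb : ∀ y : (Fin (M.B + 1) × Info M) × Bool,
      |M.cost ⟨y.1.1, y.1.2.obs⟩ y.2| ≤ M.Δmax := fun y => abs_cost_le _ _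
  have hb' : ∀ x : Fin (M.B + 1) × Info M, |(x.2.obs.r.toNat : ℝ)| ≤ 1 :=
    fun x => hr ⟨x.1, x.2.obs⟩
  simp only [expAoI, PMF.expVal_bind _ _ hb, PMF.expVal_map _ _ hb, Function.comp_def]
  simp only [cost_of_Δmax_eq_one hΔ, PMF.expVal_const]
  simp only [law, PMF.expVal_bind _ _ hb', PMF.expVal_map _ _ hb', Function.comp_def]
  have hobs : ∀ (φ : Info M) a o, (φ.extend a o).obs = o := fun _ _ _ => rfl
  have : ∀ s a, ((M.step s a).expVal fun s' => (s'.o.r.toNat : ℝ)) = M.p := by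
    intro s a
    rw [M.expVal_step s a hr]
    simp [nextState, reqProb]
  simp only [hobs, this, PMF.expVal_const]
  rw [← Finset.sum_mul, hz.1.2, one_mul]

/-- Taking `S = 0`, the function `r` solves the Bellman equation with constant `p`; the shift `S`
serves the iteration in `eq_p_of_Δmax_eq_one`. -/
theorem Q_req_add_const_of_Δmax_eq_one (hΔ : M.Δmax = 1) (S : ℝ) {z : BeliefState M}
    (hz : z ∈ M.Z) (a : Bool) :
    M.Q (fun y => (y.o.r.toNat : ℝ) + S) z a = z.o.r.toNat + M.p + S := by
  rw [M.Q_add_const _ S hz, Q_eq]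
  have hs := M.add_sum_erase_of_mem_Z hz
  have hp : ∑ r' : Bool, M.reqProb r' * (r'.toNat : ℝ) = M.p := by simp [reqProb]
  have h1 : min (z.o.Δ + 1) M.Δmax = 1 := by omega
  simp only [hp, h1, ← Finset.sum_mul]
  cases a
  · simp
  · simp only [if_true]
    push_cast
    linear_combination M.p * hs

theorem exists_mem_Z (M : SensorModel) : ∃ z, z ∈ M.Z :=
  ⟨_, M.success_mem_Z le_rfl M.one_le_B true⟩

/-- Compare `h` with the explicit solution `r`. Each application of the Bellman equation moves both
bounds on `h - r` by `p - C`, so a nonzero difference would contradict boundedness after enough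
steps. The argument uses only the equation, since `Q` need not describe the true filter here. -/
theorem eq_p_of_Δmax_eq_one (hΔ : M.Δmax = 1) {C : ℝ} {h : BeliefState M → ℝ}
    (hB : M.SolvesBellman C h) : C = M.p := by
  obtain ⟨⟨K, hK⟩, hB⟩ := hB
  obtain ⟨z₁, hz₁⟩ := M.exists_mem_Z
  have hr : ∀ z : BeliefState M, |(z.o.r.toNat : ℝ)| ≤ 1 := by
    intro z
    cases z.o.r <;> simp
  have hg : ∀ z ∈ M.Z, |h z - z.o.r.toNat| ≤ K + 1 := fun z hz =>
    (abs_sub _ _).trans (add_le_add (hK z hz) (hr z))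
  have hup : ∀ n : ℕ, ∀ z ∈ M.Z, h z - z.o.r.toNat ≤ K + 1 + n * (M.p - C) := by
    intro n
    induction n with
    | zero => intro z hz; simpa using (abs_le.1 (hg z hz)).2
    | succ n ih =>
      intro z hz
      have h1 := M.Q_mono (h := h) (h' := fun y => (y.o.r.toNat : ℝ) + (K + 1 + n * (M.p - C)))
        (fun y hy => by linarith [ih y hy]) hz false
      rw [Q_req_add_const_of_Δmax_eq_one hΔ _ hz] at h1
      have h2 := min_le_left (M.Q h z false) (M.Q h z true)
      rw [← hB z hz] at h2
      push_cast
      linarith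
  have hlo : ∀ n : ℕ, ∀ z ∈ M.Z, -(K + 1) + n * (M.p - C) ≤ h z - z.o.r.toNat := by
    intro n
    induction n with
    | zero => intro z hz; simpa using (abs_le.1 (hg z hz)).1
    | succ n ih =>
      intro z hz
      have h1 : ∀ a, _ ≤ M.Q h z a := fun a => M.Q_mono
        (h := fun y => (y.o.r.toNat : ℝ) + (-(K + 1) + n * (M.p - C))) (h' := h)
        (fun y hy => by linarith [ih y hy]) hz a
      simp only [Q_req_add_const_of_Δmax_eq_one hΔ _ hz] at h1
      have h2 := le_min (h1 false) (h1 true)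
      rw [← hB z hz] at h2
      push_cast
      linarith
  by_contra hne
  obtain ⟨n, hn⟩ := exists_nat_gt (2 * (K + 1) / |M.p - C|)
  have hpos : 0 < |M.p - C| := abs_pos.2 (sub_ne_zero.2 (Ne.symm hne))
  rw [div_lt_iff₀ hpos] at hn
  have h1 := hup n z₁ hz₁
  have h2 := hlo n z₁ hz₁
  have h3 := abs_le.1 (hg z₁ hz₁)
  rcases abs_cases (M.p - C) with ⟨h4, -⟩ | ⟨h4, -⟩ <;> rw [h4] at hn <;> linarith [h3.1, h3.2]

/-! ### Verification of solutions of the Bellman equation -/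

/-- Bounds on the running average cost at rate `1/T` for a solution of the Bellman equation. -/
theorem SolvesBellman.exists_runningAvg_bounds {C : ℝ} {h : BeliefState M → ℝ}
    (hB : M.SolvesBellman C h) : ∃ K : ℝ, ∀ z₀ ∈ M.Z, ∀ T : ℕ, 0 < T →
      (∀ σ : M.InfoPolicy, C + -(2 * K) / T ≤ M.runningAvg σ z₀ T) ∧
      ∀ π : BeliefState M → Bool, M.IsGreedy h π →
        M.runningAvg (M.detPolicy π).toInfo z₀ T ≤ C + (2 * K) / T := by
  obtain ⟨K, hK⟩ := hB.1
  rcases lt_or_ge 1 M.Δmax with hΔ | hΔ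
  · exact ⟨K, fun z₀ hz T hT =>
      ⟨fun σ => le_runningAvg_of_potential (fun t => abs_infoSum_weighted_le hK σ hz t)
        (fun t => le_expAoI_add hΔ hB σ hz t) hT,
      fun π hπ => runningAvg_le_of_potential (fun t => abs_infoSum_weighted_le hK _ hz t)
        (fun t => (expAoI_add_greedy hΔ hB hπ hz t).le) hT⟩⟩
  · have hΔ1 : M.Δmax = 1 := le_antisymm hΔ M.one_le_Δmax
    have havg : ∀ (σ : M.InfoPolicy), ∀ z₀ ∈ M.Z, ∀ T : ℕ, 0 < T → M.runningAvg σ z₀ T = C := by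
      intro σ z₀ hz T hT
      have hT' : (0 : ℝ) < T := by exact_mod_cast hT
      rw [runningAvg_eq, eq_p_of_Δmax_eq_one hΔ1 hB]
      simp only [expAoI_succ_of_Δmax_eq_one hΔ1 σ hz, Finset.sum_const, Finset.card_range,
        nsmul_eq_mul]
      field_simp
    refine ⟨0, fun z₀ hz T hT => ⟨fun σ => ?_, fun π _ => ?_⟩⟩
    · simp [havg σ z₀ hz T hT]
    · simp [havg _ z₀ hz T hT]

theorem SolvesBellman.le_liminf {C : ℝ} {h : BeliefState M → ℝ} (hB : M.SolvesBellman C h)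
    (σ : M.InfoPolicy) {z₀ : BeliefState M} (hz : z₀ ∈ M.Z) :
    C ≤ liminf (fun T => M.runningAvg σ z₀ T) atTop := by
  obtain ⟨K, hK⟩ := hB.exists_runningAvg_bounds
  have ht := tendsto_const_div_nat C (-(2 * K))
  rw [← ht.liminf_eq]
  refine liminf_le_liminf ?_ ht.isBoundedUnder_ge
    (isBoundedUnder_runningAvg σ hz).1.isCoboundedUnder_ge
  filter_upwards [eventually_gt_atTop 0] with T hT
  exact (hK z₀ hz T hT).1 σ

theorem SolvesBellman.tendsto_of_isGreedy {C : ℝ} {h : BeliefState M → ℝ}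
    (hB : M.SolvesBellman C h) {π : BeliefState M → Bool} (hπ : M.IsGreedy h π)
    {z₀ : BeliefState M} (hz : z₀ ∈ M.Z) :
    Tendsto (fun T => M.runningAvg (M.detPolicy π).toInfo z₀ T) atTop (𝓝 C) := by
  obtain ⟨K, hK⟩ := hB.exists_runningAvg_bounds
  refine tendsto_of_tendsto_of_tendsto_of_le_of_le' (tendsto_const_div_nat C (-(2 * K)))
    (tendsto_const_div_nat C (2 * K)) ?_ ?_
  · filter_upwards [eventually_gt_atTop 0] with T hT
    exact (hK z₀ hz T hT).1 _
  · filter_upwards [eventually_gt_atTop 0] with T hT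
    exact (hK z₀ hz T hT).2 π hπ

theorem exists_isGreedy (h : BeliefState M → ℝ) : ∃ π, M.IsGreedy h π := by
  refine ⟨fun z => decide (M.Q h z true ≤ M.Q h z false), fun z _ a => ?_⟩
  by_cases hc : M.Q h z true ≤ M.Q h z false
  · cases a <;> simp [hc]
  · cases a <;> simp [hc, (not_le.1 hc).le]

theorem SolvesBellman.isLeast_avgCost {C : ℝ} {h : BeliefState M → ℝ}
    (hB : M.SolvesBellman C h) {z₀ : BeliefState M} (hz : z₀ ∈ M.Z) :
    IsLeast (Set.range fun π : M.Policy => M.avgCost π.toInfo z₀) C := by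
  constructor
  · obtain ⟨π, hπ⟩ := exists_isGreedy h
    exact ⟨M.detPolicy π, (hB.tendsto_of_isGreedy hπ hz).limsup_eq⟩
  · rintro _ ⟨π, rfl⟩
    have hb := isBoundedUnder_runningAvg π.toInfo hz
    exact (hB.le_liminf π.toInfo hz).trans (liminf_le_limsup hb.1 hb.2)

end SensorModel

end

noncomputable section

namespace SensorModel

variable {M : SensorModel}

/-! ### Action values: bounds and limits -/

theorem Q_zero_nonneg {z : BeliefState M} (hz : z ∈ M.Z) (a : Bool) :
    0 ≤ M.Q (fun _ => 0) z a := by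
  rw [Q_eq]
  have h0 := hz.1.1 0
  have h1 := M.β_le_one hz 0
  cases a
  · simp only [Bool.false_eq_true, if_false, mul_zero, Finset.sum_const_zero, add_zero]
    positivity
  · simp only [if_true, mul_zero, Finset.sum_const_zero, add_zero]
    have : 0 ≤ 1 - z.β 0 := by linarith
    positivity

theorem Q_zero_le {z : BeliefState M} (hz : z ∈ M.Z) (a : Bool) :
    M.Q (fun _ => 0) z a ≤ M.Δmax := by
  rw [Q_eq]
  have h0 := hz.1.1 0
  have h1 := M.β_le_one hz 0
  have hr : (z.o.r.toNat : ℝ) ≤ 1 := by cases z.o.r <;> simp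
  have hΔ : ((min (z.o.Δ + 1) M.Δmax : ℕ) : ℝ) ≤ M.Δmax := by exact_mod_cast min_le_right _ _
  have h1Δ : (1 : ℝ) ≤ M.Δmax := by exact_mod_cast M.one_le_Δmax
  cases a
  · simp only [Bool.false_eq_true, if_false, mul_zero, Finset.sum_const_zero, add_zero]
    exact (mul_le_of_le_one_left (Nat.cast_nonneg _) hr).trans hΔ
  · simp only [if_true, mul_zero, Finset.sum_const_zero, add_zero]
    have hc : z.β 0 * (min (z.o.Δ + 1) M.Δmax : ℕ) + (1 - z.β 0) ≤ M.Δmax := by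
      nlinarith [mul_le_mul_of_nonneg_left hΔ h0,
        mul_le_mul_of_nonneg_left h1Δ (sub_nonneg.2 h1)]
    have hc0 : 0 ≤ z.β 0 * (min (z.o.Δ + 1) M.Δmax : ℕ) + (1 - z.β 0) := by
      have : 0 ≤ 1 - z.β 0 := by linarith
      positivity
    exact (mul_le_of_le_one_left hc0 hr).trans hc

theorem le_Q_of_le {h : BeliefState M → ℝ} {m : ℝ} (hm : ∀ z ∈ M.Z, m ≤ h z) {z : BeliefState M}
    (hz : z ∈ M.Z) (a : Bool) : m ≤ M.Q h z a := by
  have h1 := M.Q_mono (h := fun _ => 0 + m) (h' := h) (fun y hy => by simpa using hm y hy) hz a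
  rw [M.Q_add_const (fun _ => 0) m hz] at h1
  linarith [Q_zero_nonneg hz a]

theorem Q_le_of_le {h : BeliefState M → ℝ} {S : ℝ} (hS : ∀ z ∈ M.Z, h z ≤ S) {z : BeliefState M}
    (hz : z ∈ M.Z) (a : Bool) : M.Q h z a ≤ M.Δmax + S := by
  have h1 := M.Q_mono (h := h) (h' := fun _ => 0 + S) (fun y hy => by simpa using hS y hy) hz a
  rw [M.Q_add_const (fun _ => 0) S hz] at h1
  linarith [Q_zero_le hz a]

/-- For fixed `z` only finitely many successors enter `Q`, so pointwise convergence is enough. -/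
theorem tendsto_Q {ι : Type*} {l : Filter ι} {h : ι → BeliefState M → ℝ} {h' : BeliefState M → ℝ}
    (hh : ∀ z ∈ M.Z, Tendsto (fun n => h n z) l (𝓝 (h' z))) {z : BeliefState M} (hz : z ∈ M.Z)
    (a : Bool) : Tendsto (fun n => M.Q (h n) z a) l (𝓝 (M.Q h' z a)) := by
  simp only [Q_eq]
  cases a
  · simp only [Bool.false_eq_true, if_false]
    refine tendsto_const_nhds.add (tendsto_finsetSum _ fun r' _ => ?_)
    exact (hh _ (M.idle_mem_Z hz r')).const_mul _
  · simp only [if_true]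
    refine (tendsto_const_nhds.add (Tendsto.const_mul _ ?_)).add ?_
    · exact tendsto_finsetSum _ fun r' _ => (hh _ (M.fail_mem_Z hz r')).const_mul _
    · refine tendsto_finsetSum _ fun j hj => Tendsto.const_mul _ ?_
      exact tendsto_finsetSum _ fun r' _ =>
        (hh _ (M.success_mem_Z (M.one_le_of_mem_erase hj) (M.le_B j) r')).const_mul _

/-- The total of the immediate cost and the continuation value after the command action, given
that the battery level is `j`. -/
def sendValue (h : BeliefState M → ℝ) (o : Obs) (j : ℕ) : ℝ :=
  if j = 0 then (o.r.toNat : ℝ) * (min (o.Δ + 1) M.Δmax : ℕ) +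
    ∑ r' : Bool, M.reqProb r' * h ⟨M.ρ 0, ⟨r', min (o.Δ + 1) M.Δmax, o.bt⟩⟩
  else (o.r.toNat : ℝ) + ∑ r' : Bool, M.reqProb r' * h ⟨M.ρ (min j M.B), ⟨r', 1, min j M.B⟩⟩

/-- The continuation after a command depends only on the level it reveals, so the action value is
linear in the belief and can be compared in the stochastic order. -/
theorem Q_true_eq_sum (h : BeliefState M → ℝ) {z : BeliefState M} (hz : z ∈ M.Z) :
    M.Q h z true = ∑ j, z.β j * sendValue h z.o j := by
  rw [Q_eq, ← Finset.add_sum_erase _ _ (Finset.mem_univ (0 : Fin (M.B + 1)))]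
  have hs := M.add_sum_erase_of_mem_Z hz
  have h1 : ∑ j ∈ Finset.univ.erase (0 : Fin (M.B + 1)), z.β j * sendValue h z.o j =
      (z.o.r.toNat : ℝ) * ∑ j ∈ Finset.univ.erase (0 : Fin (M.B + 1)), z.β j +
      ∑ j ∈ Finset.univ.erase (0 : Fin (M.B + 1)), z.β j *
          ∑ r' : Bool, M.reqProb r' * h ⟨M.ρ j, ⟨r', 1, j⟩⟩ := by
    rw [Finset.mul_sum, ← Finset.sum_add_distrib]
    refine Finset.sum_congr rfl fun j hj => ?_
    have hj0 : (j : ℕ) ≠ 0 := by have := M.one_le_of_mem_erase hj; omega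
    rw [sendValue, if_neg hj0, min_eq_left (M.le_B j)]
    ring
  rw [h1]
  simp only [if_true, sendValue, Fin.val_zero]
  linear_combination (-(z.o.r.toNat : ℝ)) * hs

/-! ### Monotonicity in the stochastic order -/

/-- `z` is at least as favourable as `z'`: the request indicators agree, the age is not larger and
the battery level is stochastically not smaller. -/
structure Favourable (z z' : BeliefState M) : Prop where
  r_eq : z.o.r = z'.o.r
  Δ_le : z.o.Δ ≤ z'.o.Δ
  sum_le : ∀ c : ℕ → ℝ, Antitone c → ∑ j, z.β j * c j ≤ ∑ j, z'.β j * c j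

/-- `h` does not increase when the belief-state becomes more favourable. -/
def MonotoneValue (h : BeliefState M → ℝ) : Prop :=
  ∀ z ∈ M.Z, ∀ z' ∈ M.Z, Favourable z z' → h z ≤ h z'

theorem sum_ρ_mul_anti {i j : ℕ} (hij : i ≤ j) (hj : j ≤ M.B) {c : ℕ → ℝ} (hc : Antitone c) :
    ∑ k, M.ρ j k * c k ≤ ∑ k, M.ρ i k * c k := by
  rw [M.sum_ρ_mul hj, M.sum_ρ_mul (hij.trans hj)]
  have h1 := mul_le_mul_of_nonneg_left (hc (show max i 1 - 1 ≤ max j 1 - 1 by omega))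
    (sub_nonneg.2 M.lam_le_one)
  have h2 := mul_le_mul_of_nonneg_left (hc (show max i 1 ≤ max j 1 by omega)) M.lam_nonneg
  linarith

theorem favourable_idle {z z' : BeliefState M} (h : Favourable z z') (r' : Bool) :
    Favourable (M := M) ⟨M.Λmat.mulVec z.β, ⟨r', min (z.o.Δ + 1) M.Δmax, z.o.bt⟩⟩
      ⟨M.Λmat.mulVec z'.β, ⟨r', min (z'.o.Δ + 1) M.Δmax, z'.o.bt⟩⟩ := by
  refine ⟨rfl, ?_, fun c hc => ?_⟩
  · have := h.Δ_le
    simp only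
    omega
  · simp only [sum_mulVec_mul]
    refine h.sum_le (fun j => (1 - M.lam) * c j + M.lam * c (min (j + 1) M.B)) fun i j hij => ?_
    have h1 := mul_le_mul_of_nonneg_left (hc hij) (sub_nonneg.2 M.lam_le_one)
    have h2 := mul_le_mul_of_nonneg_left
      (hc (show min (i + 1) M.B ≤ min (j + 1) M.B by omega)) M.lam_nonneg
    simp only
    linarith

/-- More energy means a lower resulting age and a stochastically larger next level. The truncation
`min j M.B` in `sendValue` makes it antitone on all of `ℕ`, as a test function in `Favourable` must
be. -/
theorem sendValue_antitone {h : BeliefState M → ℝ} (hh : MonotoneValue h) {z : BeliefState M}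
    (hz : z ∈ M.Z) : Antitone (sendValue h z.o) := by
  have hB := M.one_le_B
  have hΔ := M.one_le_Δmax
  intro i j hij
  simp only [sendValue]
  by_cases hj : j = 0
  · have hi : i = 0 := by omega
    rw [if_pos hi, if_pos hj]
  rw [if_neg hj]
  by_cases hi : i = 0
  · rw [if_pos hi]
    have h1 : (1 : ℝ) ≤ (min (z.o.Δ + 1) M.Δmax : ℕ) := by
      exact_mod_cast (by omega : 1 ≤ min (z.o.Δ + 1) M.Δmax)
    refine add_le_add (le_mul_of_one_le_right (Nat.cast_nonneg _) h1) (M.sum_reqProb_le fun r' => ?_)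
    refine hh _ (M.success_mem_Z (by omega) (by omega) r') _ (M.fail_mem_Z hz r') ⟨rfl, ?_, ?_⟩
    · simp only
      omega
    · intro c hc
      exact sum_ρ_mul_anti (Nat.zero_le _) (by omega) hc
  · rw [if_neg hi]
    refine add_le_add le_rfl (M.sum_reqProb_le fun r' => ?_)
    refine hh _ (M.success_mem_Z (by omega) (by omega) r') _
      (M.success_mem_Z (by omega) (by omega) r') ⟨rfl, le_rfl, ?_⟩
    intro c hc
    exact sum_ρ_mul_anti (by omega) (by omega) hc

/-- For the command, first change the belief with the observation fixed, using linearity, and then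
the observation with the belief fixed. -/
theorem Q_le_Q_of_favourable {h : BeliefState M → ℝ} (hh : MonotoneValue h) {z z' : BeliefState M}
    (hz : z ∈ M.Z) (hz' : z' ∈ M.Z) (hzz : Favourable z z') (a : Bool) :
    M.Q h z a ≤ M.Q h z' a := by
  have hΔ : ((min (z.o.Δ + 1) M.Δmax : ℕ) : ℝ) ≤ (min (z'.o.Δ + 1) M.Δmax : ℕ) := by
    have := hzz.Δ_le
    exact_mod_cast (by omega : min (z.o.Δ + 1) M.Δmax ≤ min (z'.o.Δ + 1) M.Δmax)
  cases a
  · simp only [Q_eq, Bool.false_eq_true, if_false, hzz.r_eq]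
    refine add_le_add (mul_le_mul_of_nonneg_left hΔ (Nat.cast_nonneg _))
      (M.sum_reqProb_le fun r' => ?_)
    exact hh _ (M.idle_mem_Z hz r') _ (M.idle_mem_Z hz' r') (favourable_idle hzz r')
  · rw [Q_true_eq_sum h hz, Q_true_eq_sum h hz']
    refine (hzz.sum_le _ (sendValue_antitone hh hz)).trans
      (Finset.sum_le_sum fun j _ => mul_le_mul_of_nonneg_left ?_ (hz'.1.1 j))
    simp only [sendValue, hzz.r_eq]
    split_ifs
    · refine add_le_add (mul_le_mul_of_nonneg_left hΔ (Nat.cast_nonneg _))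
        (M.sum_reqProb_le fun r' => ?_)
      refine hh _ (M.fail_mem_Z hz r') _ (M.fail_mem_Z hz' r') ⟨rfl, ?_, fun c _ => le_rfl⟩
      exact_mod_cast hΔ
    · exact le_rfl

/-! ### The discounted problem -/

/-- `V` is a nonnegative monotone bounded solution of the `α`-discounted Bellman equation. -/
structure IsDiscountedValue (α : ℝ) (V : BeliefState M → ℝ) : Prop where
  nonneg : ∀ z ∈ M.Z, 0 ≤ V z
  le : ∀ z ∈ M.Z, V z ≤ M.Δmax / (1 - α)
  eq_min : ∀ z ∈ M.Z, V z = min (M.Q (fun y => α * V y) z false) (M.Q (fun y => α * V y) z true)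
  mono : MonotoneValue V

/-- Value iteration for the `α`-discounted cost. -/
def valueIter (M : SensorModel) (α : ℝ) : ℕ → BeliefState M → ℝ
  | 0, _ => 0
  | n + 1, z => min (M.Q (fun y => α * valueIter M α n y) z false)
      (M.Q (fun y => α * valueIter M α n y) z true)

theorem valueIter_nonneg {α : ℝ} (h0 : 0 ≤ α) (n : ℕ) :
    ∀ z ∈ M.Z, 0 ≤ valueIter M α n z := by
  induction n with
  | zero => exact fun z _ => le_rfl
  | succ n ih =>
    intro z hz
    exact le_min (le_Q_of_le (fun y hy => mul_nonneg h0 (ih y hy)) hz _)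
      (le_Q_of_le (fun y hy => mul_nonneg h0 (ih y hy)) hz _)

theorem valueIter_le {α : ℝ} (h0 : 0 ≤ α) (h1 : α < 1) (n : ℕ) :
    ∀ z ∈ M.Z, valueIter M α n z ≤ M.Δmax / (1 - α) := by
  have h1' : 0 < 1 - α := by linarith
  induction n with
  | zero => exact fun z _ => div_nonneg (Nat.cast_nonneg _) h1'.le
  | succ n ih =>
    intro z hz
    refine (min_le_left _ _).trans ((Q_le_of_le (S := α * (M.Δmax / (1 - α)))
      (fun y hy => mul_le_mul_of_nonneg_left (ih y hy) h0) hz _).trans_eq ?_)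
    field_simp
    ring

theorem valueIter_le_succ {α : ℝ} (h0 : 0 ≤ α) (n : ℕ) :
    ∀ z ∈ M.Z, valueIter M α n z ≤ valueIter M α (n + 1) z := by
  induction n with
  | zero => exact fun z hz => valueIter_nonneg h0 1 z hz
  | succ n ih =>
    intro z hz
    exact min_le_min (M.Q_mono (fun y hy => mul_le_mul_of_nonneg_left (ih y hy) h0) hz _)
      (M.Q_mono (fun y hy => mul_le_mul_of_nonneg_left (ih y hy) h0) hz _)

theorem monotoneValue_valueIter {α : ℝ} (h0 : 0 ≤ α) (n : ℕ) :
    MonotoneValue (valueIter M α n) := by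
  induction n with
  | zero => exact fun _ _ _ _ _ => le_rfl
  | succ n ih =>
    have ih' : MonotoneValue fun y => α * valueIter M α n y :=
      fun z hz z' hz' hzz => mul_le_mul_of_nonneg_left (ih z hz z' hz' hzz) h0
    intro z hz z' hz' hzz
    exact min_le_min (Q_le_Q_of_favourable ih' hz hz' hzz _)
      (Q_le_Q_of_favourable ih' hz hz' hzz _)

/-- The iterates increase and are bounded, so they converge pointwise; positivity, the bound, the
equation and monotonicity pass to the limit. -/
theorem exists_isDiscountedValue (M : SensorModel) {α : ℝ} (h0 : 0 ≤ α) (h1 : α < 1) :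
    ∃ V : BeliefState M → ℝ, IsDiscountedValue α V := by
  have hlim : ∀ z ∈ M.Z, Tendsto (fun n => valueIter M α n z) atTop
      (𝓝 (⨆ n, valueIter M α n z)) := by
    intro z hz
    refine tendsto_atTop_ciSup (monotone_nat_of_le_succ fun n => valueIter_le_succ h0 n z hz) ?_
    refine ⟨M.Δmax / (1 - α), ?_⟩
    rintro _ ⟨n, rfl⟩
    exact valueIter_le h0 h1 n z hz
  refine ⟨fun z => ⨆ n, valueIter M α n z, ?_, ?_, ?_, ?_⟩
  · exact fun z hz => ge_of_tendsto' (hlim z hz) fun n => valueIter_nonneg h0 n z hz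
  · exact fun z hz => le_of_tendsto' (hlim z hz) fun n => valueIter_le h0 h1 n z hz
  · intro z hz
    have hQ : ∀ a, Tendsto (fun n => M.Q (fun y => α * valueIter M α n y) z a) atTop
        (𝓝 (M.Q (fun y => α * ⨆ n, valueIter M α n y) z a)) :=
      fun a => tendsto_Q (fun y hy => (hlim y hy).const_mul α) hz a
    exact tendsto_nhds_unique ((tendsto_add_atTop_iff_nat 1).2 (hlim z hz))
      ((hQ false).min (hQ true))
  · exact fun z hz z' hz' hzz => le_of_tendsto_of_tendsto' (hlim z hz) (hlim z' hz')
      fun n => monotoneValue_valueIter h0 n z hz z' hz' hzz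

/-- A contraction argument for lower bounds. -/
theorem le_of_contraction {α : ℝ} (h0 : 0 ≤ α) (h1 : α < 1) {V g : BeliefState M → ℝ} {m₀ : ℝ}
    (hm₀ : 0 ≤ m₀) (hV : ∀ z ∈ M.Z, g z - m₀ ≤ V z)
    (hstep : ∀ m, 0 ≤ m → (∀ z ∈ M.Z, g z - m ≤ V z) → ∀ z ∈ M.Z, g z - α * m ≤ V z) :
    ∀ z ∈ M.Z, g z ≤ V z := by
  have hn : ∀ n : ℕ, ∀ z ∈ M.Z, g z - α ^ n * m₀ ≤ V z := by
    intro n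
    induction n with
    | zero => simpa using hV
    | succ n ih =>
      have := hstep (α ^ n * m₀) (by positivity) ih
      simpa only [pow_succ', mul_assoc] using this
  intro z hz
  have ht : Tendsto (fun n : ℕ => g z - α ^ n * m₀) atTop (𝓝 (g z - 0 * m₀)) :=
    ((tendsto_pow_atTop_nhds_zero_of_lt_one h0 h1).mul_const m₀).const_sub _
  simpa using le_of_tendsto' ht fun n => hn n z hz

/-! ### Estimates on discounted values, uniform up to a reference constant. -/

namespace IsDiscountedValue

variable {α : ℝ} {V : BeliefState M → ℝ}

theorem sum_reqProb_affine (a b : ℝ) :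
    ∑ r' : Bool, M.reqProb r' * ((r'.toNat : ℝ) * a + b) = M.p * a + b := by
  simp [reqProb]
  ring

theorem toNat_le_one (b : Bool) : (b.toNat : ℝ) ≤ 1 := by cases b <;> simp

theorem nextAge_le (o : Obs) : ((min (o.Δ + 1) M.Δmax : ℕ) : ℝ) ≤ M.Δmax := by
  exact_mod_cast min_le_right _ _

/-- The bound obtained by never sending a command. -/
theorem le_idle (hV : IsDiscountedValue α V) (h0 : 0 ≤ α) (h1 : α < 1) {z : BeliefState M}
    (hz : z ∈ M.Z) :
    V z ≤ (z.o.r.toNat : ℝ) * M.Δmax + α * (M.p * M.Δmax / (1 - α)) := by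
  have h1' : 0 < 1 - α := by linarith
  have hD0 : 0 ≤ M.p * M.Δmax / (1 - α) :=
    div_nonneg (mul_nonneg M.p_nonneg (Nat.cast_nonneg _)) h1'.le
  set D := M.p * M.Δmax / (1 - α) with hD
  have hDeq : M.p * M.Δmax + α * D = D := by
    rw [hD]
    field_simp
    ring
  -- The contraction lemma is used with the discounted value as the lower function; the upper one
  -- charges `Δmax` for every request forever.
  have key := le_of_contraction (M := M) h0 h1
    (V := fun z => (z.o.r.toNat : ℝ) * M.Δmax + α * D) (g := V) (m₀ := M.Δmax / (1 - α))
    (div_nonneg (Nat.cast_nonneg _) h1'.le) (fun z hz => ?_) (fun m hm ih z hz => ?_) z hz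
  · exact key
  · have := hV.le z hz
    have : 0 ≤ (z.o.r.toNat : ℝ) * M.Δmax + α * D := by positivity
    linarith
  · have h2 := (hV.eq_min z hz).trans_le (min_le_left _ _)
    rw [Q_eq] at h2
    simp only [Bool.false_eq_true, if_false] at h2
    have h3 := M.sum_reqProb_le (f := fun r' => α * V ⟨M.Λmat.mulVec z.β,
        ⟨r', min (z.o.Δ + 1) M.Δmax, z.o.bt⟩⟩)
      (g := fun r' => (r'.toNat : ℝ) * (α * M.Δmax) + α * (α * D + m)) fun r' => by
        have := mul_le_mul_of_nonneg_left (ih _ (M.idle_mem_Z hz r')) h0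
        simp only at this
        linarith
    rw [sum_reqProb_affine] at h3
    have h4 := mul_le_mul_of_nonneg_left (nextAge_le (M := M) z.o)
      (Nat.cast_nonneg (α := ℝ) z.o.r.toNat)
    have h5 : M.p * (α * M.Δmax) + α * (α * D + m) = α * D + α * m := by
      linear_combination α * hDeq
    linarith

/-- The mean value right after a successful update from the full battery level. -/
def fullValue (V : BeliefState M → ℝ) : ℝ :=
  ∑ r' : Bool, M.reqProb r' * V ⟨M.ρ M.B, ⟨r', 1, M.B⟩⟩

theorem fullValue_nonneg (hV : IsDiscountedValue α V) : 0 ≤ fullValue V :=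
  Finset.sum_nonneg fun r' _ =>
    mul_nonneg (M.reqProb_nonneg r') (hV.nonneg _ (M.success_mem_Z M.one_le_B le_rfl r'))

/-- The right side is free of `α`: replacing `fullValue V` by its discounted version costs at most
`p * Δmax`, which the drift inequality can absorb. -/
theorem fullValue_le (hV : IsDiscountedValue α V) (h0 : 0 ≤ α) (h1 : α < 1) :
    (1 - α) * fullValue V ≤ M.p * M.Δmax := by
  have h1' : 0 < 1 - α := by linarith
  have h2 := M.sum_reqProb_le fun r' =>
    hV.le_idle h0 h1 (M.success_mem_Z M.one_le_B le_rfl r')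
  simp only at h2
  rw [sum_reqProb_affine] at h2
  have h3 : (1 - α) * (M.p * M.Δmax + α * (M.p * M.Δmax / (1 - α))) = M.p * M.Δmax := by
    field_simp
    ring
  rw [← h3]
  exact mul_le_mul_of_nonneg_left h2 h1'.le

/-- The drift inequality for the idle action. -/
theorem idle_drift {z : BeliefState M} (hz : z ∈ M.Z) (h1 : α < 1) {v : ℝ}
    (hv : (1 - α) * v ≤ M.p * M.Δmax) :
    v + (z.o.r.toNat : ℝ) * M.Δmax - 2 * M.Δmax - M.Δmax * (M.Δmax - z.o.Δ) ≤
      (z.o.r.toNat : ℝ) * (min (z.o.Δ + 1) M.Δmax : ℕ) +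
      α * (v + M.p * M.Δmax - 2 * M.Δmax - M.Δmax * (M.Δmax - (min (z.o.Δ + 1) M.Δmax : ℕ))) := by
  have hp : M.p * M.Δmax ≤ M.Δmax := mul_le_of_le_one_left (Nat.cast_nonneg _) M.p_le_one
  have hr := toNat_le_one z.o.r
  have hr0 : (0 : ℝ) ≤ z.o.r.toNat := Nat.cast_nonneg _
  have hΔ0 : (0 : ℝ) ≤ M.Δmax := Nat.cast_nonneg _
  have hp' := mul_le_mul_of_nonneg_left hp (sub_nonneg.2 h1.le)
  have hK := mul_nonneg (sub_nonneg.2 h1.le) hΔ0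
  -- Below the cap, ageing raises the potential by `Δmax`, which covers the cost shortfall `r *
  -- (Δmax - Δ - 1)`. At the cap there is no shortfall.
  rcases hz.2.1.2.lt_or_eq with h | h
  · rw [min_eq_left (show z.o.Δ + 1 ≤ M.Δmax from h)]
    have h' : (z.o.Δ : ℝ) + 1 ≤ M.Δmax := by exact_mod_cast h
    push_cast
    have e1 : (z.o.r.toNat : ℝ) * (M.Δmax - (z.o.Δ + 1)) ≤ M.Δmax := by
      have : (z.o.r.toNat : ℝ) * (M.Δmax - (z.o.Δ + 1)) ≤ 1 * (M.Δmax - (z.o.Δ + 1)) :=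
        mul_le_mul_of_nonneg_right hr (by linarith)
      have : (0 : ℝ) ≤ z.o.Δ := Nat.cast_nonneg _
      linarith
    have e2 : 0 ≤ (1 - α) * (M.Δmax * (M.Δmax - (z.o.Δ + 1))) :=
      mul_nonneg (sub_nonneg.2 h1.le) (mul_nonneg hΔ0 (by linarith))
    nlinarith
  · rw [min_eq_right (show M.Δmax ≤ z.o.Δ + 1 by omega), h]
    nlinarith

/-- Every value exceeds `fullValue V` up to an additive constant. -/
theorem fullValue_sub_le (hV : IsDiscountedValue α V) (h0 : 0 ≤ α) (h1 : α < 1)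
    {z : BeliefState M} (hz : z ∈ M.Z) :
    fullValue V + (z.o.r.toNat : ℝ) * M.Δmax - 2 * M.Δmax - M.Δmax * (M.Δmax - z.o.Δ) ≤ V z := by
  have hv := hV.fullValue_le h0 h1
  have hv0 := hV.fullValue_nonneg
  have hΔ0 : (0 : ℝ) ≤ M.Δmax := Nat.cast_nonneg _
  have hp : M.p * M.Δmax ≤ M.Δmax := mul_le_of_le_one_left (Nat.cast_nonneg _) M.p_le_one
  have hmulΔ : ∀ z ∈ M.Z, 0 ≤ (M.Δmax : ℝ) * (M.Δmax - z.o.Δ) ∧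
      (z.o.r.toNat : ℝ) * M.Δmax ≤ M.Δmax := by
    intro z hz
    have : (z.o.Δ : ℝ) ≤ M.Δmax := by exact_mod_cast hz.2.1.2
    exact ⟨mul_nonneg hΔ0 (by linarith), mul_le_of_le_one_left hΔ0 (toNat_le_one _)⟩
  refine le_of_contraction (M := M) h0 h1 (V := V)
    (g := fun z => fullValue V + (z.o.r.toNat : ℝ) * M.Δmax - 2 * M.Δmax -
      M.Δmax * (M.Δmax - z.o.Δ)) (m₀ := fullValue V) hv0 (fun z hz => ?_)
    (fun m hm ih z hz => ?_) z hz
  · have := hmulΔ z hz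
    have := hV.nonneg z hz
    linarith
  · rw [hV.eq_min z hz]
    refine le_min ?_ ?_
    · rw [Q_eq]
      simp only [Bool.false_eq_true, if_false]
      have h3 := M.sum_reqProb_le (g := fun r' => α * V ⟨M.Λmat.mulVec z.β,
          ⟨r', min (z.o.Δ + 1) M.Δmax, z.o.bt⟩⟩)
        (f := fun r' => (r'.toNat : ℝ) * (α * M.Δmax) + α * (fullValue V - 2 * M.Δmax -
          M.Δmax * (M.Δmax - (min (z.o.Δ + 1) M.Δmax : ℕ)) - m)) fun r' => by
          have := mul_le_mul_of_nonneg_left (ih _ (M.idle_mem_Z hz r')) h0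
          simp only at this
          linarith
      rw [sum_reqProb_affine] at h3
      have := idle_drift hz h1 hv
      linarith
    · rw [Q_true_eq_sum _ hz]
      -- A full battery is the best level at which to send. The `2 * Δmax` in the bound then pays
      -- for `(1 - α) * fullValue V` and for the request term, each at most `Δmax`.
      have h2 : ∀ j : Fin (M.B + 1), α * fullValue V ≤ sendValue (fun y => α * V y) z.o j := by
        intro j
        have hB := M.one_le_B
        have hα : MonotoneValue fun y => α * V y :=
          fun z hz z' hz' hzz => mul_le_mul_of_nonneg_left (hV.mono z hz z' hz' hzz) h0
        refine le_trans ?_ (sendValue_antitone hα hz (M.le_B j))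
        rw [sendValue, if_neg (by omega), min_self, fullValue, Finset.mul_sum]
        simp only [mul_left_comm α]
        linarith [Nat.cast_nonneg (α := ℝ) z.o.r.toNat]
      have h3 : α * fullValue V ≤ ∑ j, z.β j * sendValue (fun y => α * V y) z.o j := by
        calc α * fullValue V = ∑ j, z.β j * (α * fullValue V) := by
              rw [← Finset.sum_mul, hz.1.2, one_mul]
          _ ≤ _ := Finset.sum_le_sum fun j _ => mul_le_mul_of_nonneg_left (h2 j) (hz.1.1 j)
      have := hmulΔ z hz
      have := mul_nonneg h0 hm
      linarith

/-- The bound obtained by idling `n` times and then sending a command. -/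
theorem le_idle_send (hV : IsDiscountedValue α V) (h1 : α < 1) {S : ℝ}
    (hS : ∀ z ∈ M.Z, V z ≤ S) {n : ℕ} (hn : n ≤ M.B) : ∀ z ∈ M.Z,
    V z ≤ (n + 1) * M.Δmax + S -
      M.lam ^ n * (∑ j, z.β j * if M.B - n ≤ j then 1 else 0) * (S - fullValue V) := by
  have hαV : ∀ z ∈ M.Z, α * V z ≤ V z := fun z hz =>
    mul_le_of_le_one_left (hV.nonneg z hz) h1.le
  have hvS : fullValue V ≤ S := by
    have := M.sum_reqProb_le fun r' => hS _ (M.success_mem_Z M.one_le_B le_rfl r')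
    rwa [← Finset.sum_mul, M.sum_reqProb, one_mul] at this
  have hrΔ : ∀ o : Obs, (o.r.toNat : ℝ) * (min (o.Δ + 1) M.Δmax : ℕ) ≤ M.Δmax := fun o =>
    (mul_le_of_le_one_left (Nat.cast_nonneg _) (toNat_le_one _)).trans (nextAge_le o)
  have h1Δ : (1 : ℝ) ≤ M.Δmax := by exact_mod_cast M.one_le_Δmax
  induction n with
  | zero =>
    intro z hz
    refine ((hV.eq_min z hz).trans_le (min_le_right _ _)).trans ?_
    have hB := M.one_le_B
    -- Only a success from the full level is credited with `fullValue V`; every other outcome is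
    -- bounded by `S`.
    have hsend : ∀ j : Fin (M.B + 1), sendValue (fun y => α * V y) z.o j ≤
        M.Δmax + S - (if M.B ≤ j then 1 else 0) * (S - fullValue V) := by
      intro j
      have hjB := M.le_B j
      have havg : ∀ f : Bool → BeliefState M, (∀ r', f r' ∈ M.Z) →
          ∑ r', M.reqProb r' * (α * V (f r')) ≤ S := by
        intro f hf
        have := M.sum_reqProb_le fun r' => (hαV _ (hf r')).trans (hS _ (hf r'))
        rwa [← Finset.sum_mul, M.sum_reqProb, one_mul] at this
      simp only [sendValue]
      by_cases hj0 : (j : ℕ) = 0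
      · rw [if_pos hj0, if_neg (by omega)]
        have := hrΔ z.o
        have := havg _ fun r' => M.fail_mem_Z hz r'
        linarith
      · rw [if_neg hj0]
        have hr := toNat_le_one z.o.r
        by_cases hj : M.B ≤ j
        · rw [if_pos hj, min_eq_right hj]
          have := M.sum_reqProb_le fun r' => hαV _ (M.success_mem_Z hB le_rfl r')
          rw [fullValue]
          linarith
        · rw [if_neg hj, min_eq_left hjB]
          have := havg _ fun r' => M.success_mem_Z (j := j) (by omega) hjB r'
          linarith
    rw [Q_true_eq_sum _ hz]
    refine (Finset.sum_le_sum fun j _ => mul_le_mul_of_nonneg_left (hsend j) (hz.1.1 j)).trans_eq ?_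
    simp only [mul_sub, Finset.sum_sub_distrib, ← Finset.sum_mul, ← mul_assoc, hz.1.2]
    simp
  | succ n ih =>
    intro z hz
    refine ((hV.eq_min z hz).trans_le (min_le_left _ _)).trans ?_
    rw [Q_eq]
    simp only [Bool.false_eq_true, if_false]
    have h2 := M.sum_reqProb_le fun r' =>
      (hαV _ (M.idle_mem_Z hz r')).trans (ih (by omega) _ (M.idle_mem_Z hz r'))
    simp only at h2
    rw [← Finset.sum_mul, M.sum_reqProb, one_mul] at h2
    -- A level of at least `B - (n + 1)` followed by an arrival, of probability `lam`, gives a level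
    -- of at least `B - n`.
    have h3 : M.lam * (∑ j, z.β j * if M.B - (n + 1) ≤ j then 1 else 0) ≤
        ∑ j, M.Λmat.mulVec z.β j * if M.B - n ≤ j then 1 else 0 := by
      rw [M.sum_mulVec_mul z.β fun j => if M.B - n ≤ j then 1 else 0, Finset.mul_sum]
      refine Finset.sum_le_sum fun j _ => ?_
      rw [mul_left_comm]
      refine mul_le_mul_of_nonneg_left ?_ (hz.1.1 j)
      have hl := M.lam_nonneg
      have hl' := M.lam_le_one
      split_ifs <;> first | omega | linarith
    have h4 := mul_le_mul_of_nonneg_right (mul_le_mul_of_nonneg_left h3 (pow_nonneg M.lam_nonneg n))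
      (sub_nonneg.2 hvS)
    have h5 := hrΔ z.o
    rw [← mul_assoc, ← pow_succ] at h4
    rw [Nat.cast_succ]
    linarith

/-- Take `S` to be the supremum of `V` and `n = B` in `le_idle_send`. The tail probability is then
1, and the supremum bounds itself: `lam ^ B * (S - fullValue V) ≤ (B + 1) * Δmax`. -/
theorem le_fullValue_add (hV : IsDiscountedValue α V) (h1 : α < 1)
    (hlam : 0 < M.lam) {z : BeliefState M} (hz : z ∈ M.Z) :
    V z ≤ fullValue V + (M.B + 1) * M.Δmax / M.lam ^ M.B := by
  have hbdd : BddAbove (V '' M.Z) := by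
    refine ⟨M.Δmax / (1 - α), ?_⟩
    rintro _ ⟨y, hy, rfl⟩
    exact hV.le y hy
  have hS : ∀ y ∈ M.Z, V y ≤ sSup (V '' M.Z) := fun y hy => le_csSup hbdd ⟨y, hy, rfl⟩
  have h2 : sSup (V '' M.Z) ≤ (M.B + 1) * M.Δmax + sSup (V '' M.Z) -
      M.lam ^ M.B * (sSup (V '' M.Z) - fullValue V) := by
    refine csSup_le ⟨_, z, hz, rfl⟩ ?_
    rintro _ ⟨y, hy, rfl⟩
    have := hV.le_idle_send h1 hS le_rfl y hy
    simpa [hy.1.2] using this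
  have hpow : 0 < M.lam ^ M.B := pow_pos hlam _
  have h3 : sSup (V '' M.Z) - fullValue V ≤ (M.B + 1) * M.Δmax / M.lam ^ M.B := by
    rw [le_div_iff₀ hpow]
    linarith
  linarith [hS z hz]

/-- Without energy arrivals, the value is that of never sending, up to an additive constant. -/
theorem le_of_lam_eq_zero (hV : IsDiscountedValue α V) (h0 : 0 ≤ α) (h1 : α < 1)
    (hlam : M.lam = 0) {z : BeliefState M} (hz : z ∈ M.Z) :
    M.p * M.Δmax / (1 - α) + (z.o.r.toNat : ℝ) * M.Δmax - 2 * M.Δmax -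
      M.Δmax * (M.Δmax - z.o.Δ) - M.Δmax ^ 2 * ∑ j, z.β j * ((j : ℕ) : ℝ) ≤ V z := by
  have h1' : 0 < 1 - α := by linarith
  have hD0 : 0 ≤ M.p * M.Δmax / (1 - α) :=
    div_nonneg (mul_nonneg M.p_nonneg (Nat.cast_nonneg _)) h1'.le
  set D := M.p * M.Δmax / (1 - α) with hD
  have hDeq : (1 - α) * D = M.p * M.Δmax := by
    rw [hD]
    field_simp
  have hΔ0 : (0 : ℝ) ≤ M.Δmax := Nat.cast_nonneg _
  have hp : M.p * M.Δmax ≤ M.Δmax := mul_le_of_le_one_left (Nat.cast_nonneg _) M.p_le_one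
  have hmulΔ : ∀ z ∈ M.Z, 0 ≤ (M.Δmax : ℝ) * (M.Δmax - z.o.Δ) ∧
      (z.o.r.toNat : ℝ) * M.Δmax ≤ M.Δmax := by
    intro z hz
    have : (z.o.Δ : ℝ) ≤ M.Δmax := by exact_mod_cast hz.2.1.2
    exact ⟨mul_nonneg hΔ0 (by linarith), mul_le_of_le_one_left hΔ0 (toNat_le_one _)⟩
  have hmean0 : ∀ z ∈ M.Z, 0 ≤ ∑ j, z.β j * ((j : ℕ) : ℝ) := fun z hz =>
    Finset.sum_nonneg fun j _ => mul_nonneg (hz.1.1 j) (Nat.cast_nonneg _)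
  refine le_of_contraction (M := M) h0 h1 (V := V)
    (g := fun z => D + (z.o.r.toNat : ℝ) * M.Δmax - 2 * M.Δmax -
      M.Δmax * (M.Δmax - z.o.Δ) - M.Δmax ^ 2 * ∑ j, z.β j * ((j : ℕ) : ℝ)) (m₀ := D) hD0
    (fun z hz => ?_) (fun m hm ih z hz => ?_) z hz
  · have := hmulΔ z hz
    have := hV.nonneg z hz
    have := mul_nonneg (sq_nonneg (M.Δmax : ℝ)) (hmean0 z hz)
    linarith
  have hnext : ∀ (β : Fin (M.B + 1) → ℝ) (A bt : ℕ),
      (∀ r', (⟨β, ⟨r', A, bt⟩⟩ : BeliefState M) ∈ M.Z) →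
      α * (D + M.p * M.Δmax - 2 * M.Δmax - M.Δmax * (M.Δmax - A)) - α * m -
        α * (M.Δmax ^ 2 * ∑ j, β j * ((j : ℕ) : ℝ)) ≤
      ∑ r', M.reqProb r' * (α * V ⟨β, ⟨r', A, bt⟩⟩) := by
    intro β A bt hmem
    have h3 := M.sum_reqProb_le (g := fun r' => α * V ⟨β, ⟨r', A, bt⟩⟩)
      (f := fun r' => (r'.toNat : ℝ) * (α * M.Δmax) + α * (D - 2 * M.Δmax -
        M.Δmax * (M.Δmax - A) - M.Δmax ^ 2 * ∑ j, β j * ((j : ℕ) : ℝ) - m)) fun r' => by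
        have := mul_le_mul_of_nonneg_left (ih _ (hmem r')) h0
        simp only at this
        linarith
    rw [sum_reqProb_affine] at h3
    linarith
  have hdrift := idle_drift hz h1 hDeq.le
  rw [hV.eq_min z hz]
  refine le_min ?_ ?_
  · rw [Q_eq]
    simp only [Bool.false_eq_true, if_false]
    have h3 := hnext _ _ _ fun r' => M.idle_mem_Z hz r'
    have h4 : ∑ j, M.Λmat.mulVec z.β j * ((j : ℕ) : ℝ) = ∑ j, z.β j * ((j : ℕ) : ℝ) := by
      rw [M.sum_mulVec_mul z.β fun j => (j : ℝ)]
      simp [hlam]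
    rw [h4] at h3
    have h5 := mul_le_of_le_one_left
      (mul_nonneg (sq_nonneg (M.Δmax : ℝ)) (hmean0 z hz)) h1.le
    linarith
  · rw [Q_true_eq_sum _ hz]
    -- Without arrivals a success lowers the mean level by exactly one, releasing `Δmax ^ 2` of
    -- potential. This pays `Δmax * (Δmax - 1)` for the age reset and `Δmax` for the request term.
    have hmean : ∀ j : ℕ, j ≤ M.B →
        ∑ i, M.ρ j i * ((i : ℕ) : ℝ) = (j : ℝ) - 1 + if j = 0 then 1 else 0 := by
      intro j hj
      rw [M.sum_ρ_mul hj fun i => (i : ℝ)]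
      rcases Nat.eq_zero_or_pos j with rfl | hj0
      · simp [hlam]
      · rw [max_eq_left hj0, if_neg (by omega), Nat.cast_sub hj0]
        simp [hlam]
    have hsend : ∀ j : Fin (M.B + 1), D + (z.o.r.toNat : ℝ) * M.Δmax - 2 * M.Δmax -
        M.Δmax * (M.Δmax - z.o.Δ) - M.Δmax ^ 2 * ((j : ℕ) : ℝ) - α * m ≤
        sendValue (fun y => α * V y) z.o j := by
      intro j
      have hjB := M.le_B j
      simp only [sendValue]
      by_cases hj0 : (j : ℕ) = 0
      · rw [if_pos hj0]
        have h3 := hnext _ _ _ fun r' => M.fail_mem_Z hz r'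
        rw [hmean 0 (Nat.zero_le _)] at h3
        simp only [hj0, Nat.cast_zero, mul_zero]
        simp only [Nat.cast_zero, if_true, zero_sub, neg_add_cancel, mul_zero] at h3
        linarith
      · rw [if_neg hj0, min_eq_left hjB]
        have h3 := hnext _ _ _ fun r' => M.success_mem_Z (j := j) (by omega) hjB r'
        rw [hmean j hjB, if_neg hj0] at h3
        have hj1 : (1 : ℝ) ≤ ((j : ℕ) : ℝ) := by exact_mod_cast Nat.one_le_iff_ne_zero.2 hj0
        have h5 : 0 ≤ (1 - α) * (M.Δmax ^ 2 * (((j : ℕ) : ℝ) - 1)) :=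
          mul_nonneg h1'.le (mul_nonneg (sq_nonneg _) (by linarith))
        have h6 := hmulΔ z hz
        have h7 : (1 : ℝ) ≤ M.Δmax := by exact_mod_cast M.one_le_Δmax
        have h8 : 0 ≤ (1 - α) * ((M.Δmax : ℝ) * (M.Δmax - 1)) :=
          mul_nonneg h1'.le (mul_nonneg hΔ0 (by linarith))
        have h9 := mul_le_mul_of_nonneg_left hp h1'.le
        have h10 := mul_nonneg h1'.le hΔ0
        have h11 : (0 : ℝ) ≤ z.o.r.toNat := Nat.cast_nonneg _
        push_cast at h3
        linarith
    refine le_trans (le_of_eq ?_)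
      (Finset.sum_le_sum fun j _ => mul_le_mul_of_nonneg_left (hsend j) (hz.1.1 j))
    simp only [mul_sub, Finset.sum_sub_distrib, mul_add, Finset.sum_add_distrib, ← Finset.sum_mul,
      hz.1.2, one_mul]
    rw [Finset.mul_sum]
    simp only [mul_left_comm]

end IsDiscountedValue

/-- The discounted values have an oscillation bounded uniformly in the discount factor. -/
theorem exists_uniform_bound (M : SensorModel) : ∃ K : ℝ, ∀ α : ℝ, 0 ≤ α → α < 1 →
    ∀ V : BeliefState M → ℝ, IsDiscountedValue α V → ∃ c : ℝ, ∀ z ∈ M.Z, |V z - c| ≤ K := by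
  have hΔ0 : (0 : ℝ) ≤ M.Δmax := Nat.cast_nonneg _
  have hlow : ∀ z ∈ M.Z, (M.Δmax : ℝ) * (M.Δmax - z.o.Δ) ≤ M.Δmax ^ 2 ∧
      0 ≤ (z.o.r.toNat : ℝ) * M.Δmax ∧ (z.o.r.toNat : ℝ) * M.Δmax ≤ M.Δmax := by
    intro z _
    refine ⟨?_, by positivity, mul_le_of_le_one_left hΔ0 (IsDiscountedValue.toNat_le_one _)⟩
    have : (0 : ℝ) ≤ M.Δmax * z.o.Δ := by positivity
    linarith
  -- If `lam = 0` a full battery cannot be regained, so `fullValue` is no longer a valid reference;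
  -- the cost of never sending replaces it.
  rcases M.lam_nonneg.eq_or_lt with hlam | hlam
  · refine ⟨2 * M.Δmax + M.Δmax ^ 2 + M.Δmax ^ 2 * M.B, fun α h0 h1 V hV =>
      ⟨M.p * M.Δmax / (1 - α), fun z hz => abs_le.2 ⟨?_, ?_⟩⟩⟩
    · have h2 := hV.le_of_lam_eq_zero h0 h1 hlam.symm hz
      have h3 : ∑ j, z.β j * ((j : ℕ) : ℝ) ≤ M.B := by
        calc ∑ j, z.β j * ((j : ℕ) : ℝ) ≤ ∑ j, z.β j * (M.B : ℝ) :=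
              Finset.sum_le_sum fun j _ => mul_le_mul_of_nonneg_left
                (by exact_mod_cast M.le_B j) (hz.1.1 j)
          _ = M.B := by rw [← Finset.sum_mul, hz.1.2, one_mul]
      have h4 := mul_le_mul_of_nonneg_left h3 (sq_nonneg (M.Δmax : ℝ))
      have := hlow z hz
      linarith
    · have h2 := hV.le_idle h0 h1 hz
      have h3 := mul_le_of_le_one_left (div_nonneg (mul_nonneg M.p_nonneg hΔ0)
        (sub_nonneg.2 h1.le)) h1.le
      have := hlow z hz
      have : (0 : ℝ) ≤ M.Δmax ^ 2 * M.B := by positivity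
      linarith [sq_nonneg (M.Δmax : ℝ)]
  · have hA : (0 : ℝ) ≤ (M.B + 1) * M.Δmax / M.lam ^ M.B := by positivity
    refine ⟨2 * M.Δmax + M.Δmax ^ 2 + (M.B + 1) * M.Δmax / M.lam ^ M.B, fun α h0 h1 V hV =>
      ⟨IsDiscountedValue.fullValue V, fun z hz => abs_le.2 ⟨?_, ?_⟩⟩⟩
    · have h2 := hV.fullValue_sub_le h0 h1 hz
      have := hlow z hz
      linarith
    · have h2 := hV.le_fullValue_add h1 hlam hz
      linarith [sq_nonneg (M.Δmax : ℝ)]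

/-! ### The vanishing discount limit -/

/-- The average-cost Bellman equation has a bounded solution. -/
theorem exists_solvesBellman (M : SensorModel) :
    ∃ (C : ℝ) (h : BeliefState M → ℝ), M.SolvesBellman C h := by
  obtain ⟨K, hK⟩ := M.exists_uniform_bound
  let α : ℕ → ℝ := fun n => 1 - 1 / ((n : ℝ) + 1)
  have hα0 : ∀ n, 0 ≤ α n := fun n => by
    have : 1 / ((n : ℝ) + 1) ≤ 1 := by
      rw [div_le_one (by positivity)]
      linarith [Nat.cast_nonneg (α := ℝ) n]
    simp only [α]
    linarith
  have hα1 : ∀ n, α n < 1 := fun n => by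
    have : 0 < 1 / ((n : ℝ) + 1) := by positivity
    simp only [α]
    linarith
  choose V hV using fun n => M.exists_isDiscountedValue (hα0 n) (hα1 n)
  choose c hc using fun n => hK _ (hα0 n) (hα1 n) _ (hV n)
  let g : ℕ → BeliefState M → ℝ := fun n z => V n z - c n
  -- Centring by `c n` leaves the constant `(1 - α n) * c n`, the candidate for the average cost.
  have hbell : ∀ n, ∀ z ∈ M.Z, (1 - α n) * c n + g n z =
      min (M.Q (fun y => α n * g n y) z false) (M.Q (fun y => α n * g n y) z true) := by
    intro n z hz
    have h1 : ∀ a, M.Q (fun y => α n * V n y) z a = M.Q (fun y => α n * g n y) z a + α n * c n := by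
      intro a
      rw [← M.Q_add_const _ _ hz]
      congr 1
      funext y
      simp only [g]
      ring
    have h2 := (hV n).eq_min z hz
    rw [h1, h1, min_add_add_right] at h2
    simp only [g] at h2 ⊢
    linarith
  -- An ultrafilter gives limits at all points of the uncountable space `M.Z` at once, with no
  -- subsequence extraction and no continuity in the belief.
  let U : Ultrafilter ℕ := hyperfilter ℕ
  have hU : (U : Filter ℕ) ≤ atTop := Nat.hyperfilter_le_atTop
  have hcpt : ∀ (f : ℕ → ℝ) (L : ℝ), (∀ n, |f n| ≤ L) →
      ∃ x, |x| ≤ L ∧ Tendsto f U (𝓝 x) := by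
    intro f L hf
    obtain ⟨x, hx, hle⟩ := (isCompact_Icc (a := -L) (b := L)).ultrafilter_le_nhds (U.map f)
      (le_principal_iff.2 (mem_map.2 (univ_mem' fun n => abs_le.1 (hf n))))
    exact ⟨x, abs_le.2 hx, hle⟩
  have hlim : ∀ z : BeliefState M, ∃ x, z ∈ M.Z → |x| ≤ K ∧ Tendsto (fun n => g n z) U (𝓝 x) := by
    intro z
    by_cases hz : z ∈ M.Z
    · obtain ⟨x, hx⟩ := hcpt (fun n => g n z) K fun n => hc n z hz
      exact ⟨x, fun _ => hx⟩
    · exact ⟨0, fun h => absurd h hz⟩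
  choose h hh using hlim
  have hαU : Tendsto α U (𝓝 1) := by
    have : Tendsto α atTop (𝓝 (1 - 0)) :=
      (tendsto_one_div_add_atTop_nhds_zero_nat (𝕜 := ℝ)).const_sub 1
    simpa using this.mono_left hU
  have hQ : ∀ z ∈ M.Z, ∀ a, Tendsto (fun n => M.Q (fun y => α n * g n y) z a) U
      (𝓝 (M.Q h z a)) := by
    intro z hz a
    refine tendsto_Q (fun y hy => ?_) hz a
    simpa using hαU.mul (hh y hy).2
  -- The sequence does not involve `z`, so uniqueness of limits makes the limiting constant the same
  -- at every belief-state.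
  have hC : ∀ z ∈ M.Z, Tendsto (fun n => (1 - α n) * c n) U
      (𝓝 (min (M.Q h z false) (M.Q h z true) - h z)) := by
    intro z hz
    refine (((hQ z hz false).min (hQ z hz true)).sub (hh z hz).2).congr fun n => ?_
    have := hbell n z hz
    linarith
  obtain ⟨z₁, hz₁⟩ := exists_mem_Z M
  refine ⟨min (M.Q h z₁ false) (M.Q h z₁ true) - h z₁, h, ⟨K, fun z hz => (hh z hz).1⟩,
    fun z hz => ?_⟩
  rw [tendsto_nhds_unique (hC z₁ hz₁) (hC z hz)]
  ring

end SensorModel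

end

theorem theorem2 (M : SensorModel) :
    (∃ (C : ℝ) (h : BeliefState M → ℝ), M.SolvesBellman C h) ∧
    ∀ (C : ℝ) (h : BeliefState M → ℝ), M.SolvesBellman C h →
      (∀ z₀ ∈ M.Z, IsLeast (Set.range fun π : M.Policy => M.avgCost π.toInfo z₀) C) ∧
      (∀ σ : M.InfoPolicy, ∀ z₀ ∈ M.Z,
        C ≤ liminf (fun T => M.runningAvg σ z₀ T) atTop) ∧
      (∀ π : BeliefState M → Bool, M.IsGreedy h π → ∀ z₀ ∈ M.Z,
        Tendsto (fun T => M.runningAvg (M.detPolicy π).toInfo z₀ T) atTop (𝓝 C)) :=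
  ⟨M.exists_solvesBellman, fun _ _ hB => ⟨fun _ hz => hB.isLeast_avgCost hz,
    fun σ _ hz => hB.le_liminf σ hz, fun _ hπ _ hz => hB.tendsto_of_isGreedy hπ hz⟩⟩
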